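/- **Definitions.** Let $S$ be a non-empty subset of $\{A,B,C,D\}$. An interval of length 2 with center $c(x)$, left endpoint $L(x)=c(x)-1$ and right endpoint $R(x)=c(x)+1$ has one of four types: $A$ (endpoints closed, center closed), $B$ (endpoints open, center open), $C$ (endpoints closed, center open), $D$ (endpoints open, center closed). An $S$-representation of a finite poset $(V,\prec)$ assigns to each element an interval of length 2 with type in $S$ so that $x\prec y$ if and only if (i) $R(x)<c(y)$, or (ii) $R(x)=c(y)$, at least one of $R(x),c(y)$ is open and at least one of $L(y),c(x)$ is open. Write $x\parallel y$ if $x\ne y$ are incomparable. A forcing cycle is a sequence $x_0,\dots,x_t=x_0$ with $x_i\prec x_{i+1}$ or $x_i\parallel x_{i+1}$ for all $i<t$; its value is the number of its steps $\prec$ minus the number of its steps $\parallel$. **Algorithm Recognize $S$-Orders.** *Input:* a poset $P=(V,\prec)$ with $|V|=n$, given by its table, and a non-empty $S\subseteq\{A,B,C,D\}$. (The algorithm is designed for posets that are twin-free and inseparable; the time bound below does not need this.) *Output:* an $S$-representation of $P$ or a certificate. All choices that are left open are arbitrary. *Start.* Choose $v_0\in V$; put $\ell(v_0)=u(v_0)=0$,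 and $\ell(v)=-n-1$, $u(v)=n+1$ for $v\neq v_0$. Put $r=0$, $V_0=V$. *Procedure NS for a pair $(v_i,v_j)$.* (1) If $v_i\prec v_j$ and $\ell(v_j)<\ell(v_i)+1$, set $\ell(v_j):=\ell(v_i)+1$, $f(v_j):=v_i$. (2) If $v_i\parallel v_j$ and $\ell(v_j)<\ell(v_i)-1$, set $\ell(v_j):=\ell(v_i)-1$, $f(v_j):=v_i$. (3) If $v_i\succ v_j$ and $u(v_j)>u(v_i)-1$, set $u(v_j):=u(v_i)-1$, $g(v_j):=v_i$. (4) If $v_i\parallel v_j$ and $u(v_j)>u(v_i)+1$, set $u(v_j):=u(v_i)+1$, $g(v_j):=v_i$. *Pass $r$.* For all $v\in V_r\setminus\{v_0\}$ set $f(v)=g(v)=\mathrm{nil}$. Let $M$ be the 0-1-matrix indexed by $V_r\setminus\{v_0\}$ with $M_{ij}=1$ if $i=j$ and $M_{ij}=0$ otherwise. Run NS for all pairs $(v_0,v)$, $v\in V_r\setminus\{v_0\}$. *Labeling loop.* Scan $M$ and choose $(i,j)$ with $M_{ij}=0$; if there is none, leave the loop. Run NS for $(v_i,v_j)$. If $\ell(v_j)>u(v_j)$,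 end the algorithm: trace $f$ and $g$ from $v_j$ until $v_0$, nil or a repeated element is reached, join the reversed $f$-trace and the $g$-trace to a forcing trail, and return the first closed part with positive value found in it. If neither $\ell(v_j)$ nor $u(v_j)$ changed, set $M_{ij}:=1$; otherwise set the nondiagonal entries in row $j$ and column $j$ of $M$ to $0$. Repeat. *Assign types.* Let $X_r=\{v\in V_r:\ell(v)=u(v)\}$ and $c(x):=\ell(x)$ for $x\in X_r$. Let $m$ and $\mu$ be the least and the greatest of these centers, and $t_j$ the number of elements of $X_r$ with center $j$, for $j=m,m+1,\dots,\mu$. If some $t_j>|S|$, fail. Otherwise create, for each $j$, one node for each list of $t_j$ distinct elements of $S$; the list gives types to the elements with center $j$, in the order of their indices. For $j=m,m+1,\dots,\mu-1$ in turn: for every node at $j$ and every node at $j+1$, if the typed intervals they determine form an $S$-representation of the elements with centers $j$ and $j+1$, set a forward and a backward pointer between these nodes; delete the nodes at $j+1$ without a backward pointer; if none remains, fail. If $j=\mu$ is reached, choose a node at $\mu$ and follow backward pointers down to $m$, assigning to the elements the types listed in the nodes that are met. On failure, end the algorithm and return the closed sequence obtained by concatenating, over $x\in X_r\setminus\{v_0\}$,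 the reversed $f$-trace from $v_0$ to $x$ and the $g$-trace from $x$ back to $v_0$ (for twin-free inseparable $P$, a forcing cycle of value $0$ through $X_r$). *Next pass.* Let $V_{r+1}=V_r\setminus X_r$. If it is empty, end the algorithm and output the centers and types. Otherwise choose a new $v_0\in V_{r+1}$, set $\ell(v_0)$ and $u(v_0)$ both to the old value of $\ell(v_0)$ plus $2^{-(r+1)}$, and begin pass $r+1$. **Cost model.** A random access machine: each operation on an index, pointer, list cell, truth value, entry of $M$ or entry of the table of $\prec$ takes one unit of time; reading, writing, comparing, adding, subtracting, halving or rounding the dyadic rational numbers $\ell,u,c$ takes time equal to the number of binary digits of the operands. **Theorem.** There is a constant $K$ such that for every $n\ge 1$, every poset $P$ with $n$ elements (in any numbering), every non-empty $S\subseteq\{A,B,C,D\}$ and every way of making the choices, Algorithm Recognize $S$-Orders on input $(P,S)$ terminates within $K n^5$ units of time; that is, it runs in $O(n^5)$ time. -/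

import Mathlib

namespace SOrder

/-! ### Interval types and the precedence rule -/

/-- The four types of intervals: `A` (endpoints closed, center closed), `B` (endpoints open,
center open), `C` (endpoints closed, center open), `D` (endpoints open, center closed). -/
inductive IType where
  | A | B | C | D
  deriving DecidableEq

/-- Both endpoints of an interval of this type are open. -/
def IType.endsOpen : IType → Bool
  | .A => false
  | .B => true
  | .C => false
  | .D => true

/-- The center of an interval of this type is open. -/
def IType.centerOpen : IType → Bool
  | .A => false
  | .B => true
  | .C => true
  | .D => false

/-- A typed interval; all intervals are scaled to have length 2. -/
structure Interval where
  center : ℚ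
  type : IType

/-- The right endpoint. -/
def Interval.right (I : Interval) : ℚ := I.center + 1

/-- `x ≺ y` for intervals: `R(x) < c(y)`, or `R(x) = c(y)`, at least one of `R(x), c(y)` is open
and at least one of `L(y), c(x)` is open. -/
def Interval.prec (x y : Interval) : Bool :=
  decide (x.right < y.center) ||
    (decide (x.right = y.center) && (x.type.endsOpen || y.type.centerOpen) &&
      (y.type.endsOpen || x.type.centerOpen))

/-- The elements of `S`, in alphabetical order. -/
def letters (S : Finset IType) : List IType :=
  [IType.A, IType.B, IType.C, IType.D].filter (fun τ => decide (τ ∈ S))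

/-- A type assignment: the list of the types given to the elements with one common center. -/
abbrev TypeList := List IType

/-- All lists of `t` distinct entries of `ls` (for `ls` without repetition). -/
def arrangements (ls : List IType) : ℕ → List TypeList
  | 0 => [[]]
  | t + 1 => (arrangements ls t).flatMap fun w =>
      (ls.filter (fun τ => decide (τ ∉ w))).map fun τ => w ++ [τ]

/-! ### The machine: memory, time budget, charged primitive operations

A random access machine whose memory is described by `Mem n`.  A computation is a partial function
of the memory and of the remaining time; it fails exactly if it runs out of time.

* An operation on indices, pointers, list cells, truth values, entries of `M`, or entries of the
  table of the order costs one unit.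
* Reading, writing, comparing or adding (dyadic) rational numbers costs the number of binary digits
  of the operands.
-/

/-- The memory of the machine, for a ground set of `n` elements numbered `0, …, n - 1`. -/
structure Mem (n : ℕ) where
  /-- lower bounds `ℓ(v)` -/
  lo : Fin n → ℚ
  /-- upper bounds `u(v)` -/
  hi : Fin n → ℚ
  /-- tracking function `f`; `none` is nil -/
  f : Fin n → Option (Fin n)
  /-- tracking function `g`; `none` is nil -/
  g : Fin n → Option (Fin n)
  /-- the 0-1-array `M`; `true` is 1 -/
  M : Fin n → Fin n → Bool
  /-- the centers `c(v)` of the representation that is built -/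
  ctr : Fin n → ℚ
  /-- the types of the representation that is built -/
  typ : Fin n → Option IType
  /-- `bucket k` lists the elements with center `m + k` -/
  bucket : ℕ → List (Fin n)
  /-- `nodes k` lists the nodes (named by their type assignments) present at center `m + k` -/
  nodes : ℕ → List TypeList
  /-- pointers of a node at center `m + k` back to nodes at center `m + k - 1` -/
  back : ℕ → TypeList → List TypeList
  /-- pointers of a node at center `m + k` forward to nodes at center `m + k + 1` -/
  fwd : ℕ → TypeList → List TypeList
  /-- how the choices that the algorithm leaves open are made -/
  choices : ℕ → ℕ
  /-- the number of choices made so far -/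
  clock : ℕ

/-- The memory at the start, with the choices to be made according to `ω`. -/
def Mem.blank (n : ℕ) (ω : ℕ → ℕ) : Mem n where
  lo := fun _ => 0
  hi := fun _ => 0
  f := fun _ => none
  g := fun _ => none
  M := fun _ _ => false
  ctr := fun _ => 0
  typ := fun _ => none
  bucket := fun _ => []
  nodes := fun _ => []
  back := fun _ _ => []
  fwd := fun _ _ => []
  choices := ω
  clock := 0

/-- Computations; the second component of the state is the time that is left. -/
abbrev Comp (n : ℕ) (α : Type) : Type := StateT (Mem n × ℕ) Option α

/-- `c` started on memory `m` terminates after at most `T` units of time. -/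
def RunsWithin {n : ℕ} {α : Type} (c : Comp n α) (m : Mem n) (T : ℕ) : Prop :=
  ∃ (a : α) (m' : Mem n) (left : ℕ), c.run (m, T) = some (a, (m', left))

section Primitives

variable {n : ℕ} {α β : Type}

/-- Spend `c` units of time. -/
def tick (c : ℕ) : Comp n Unit := fun s =>
  if c ≤ s.2 then some ((), (s.1, s.2 - c)) else none

/-- Read something from the memory, at a cost depending on what is read. -/
def load (cost : α → ℕ) (h : Mem n → α) : Comp n α := fun s =>
  (do tick (cost (h s.1)); pure (h s.1) : Comp n α) s

/-- Change the memory at the given cost. -/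
def store (cost : ℕ) (h : Mem n → Mem n) : Comp n Unit := fun s =>
  (do tick cost; fun s' => some ((), (h s'.1, s'.2)) : Comp n Unit) s

/-- The number of binary digits of numerator and denominator, and a sign bit. -/
def bits (q : ℚ) : ℕ := 1 + Nat.size q.num.natAbs + Nat.size q.den

def add (a b : ℚ) : Comp n ℚ := do tick (bits a + bits b); pure (a + b)
def sub (a b : ℚ) : Comp n ℚ := do tick (bits a + bits b); pure (a - b)
def halve (a : ℚ) : Comp n ℚ := do tick (bits a); pure (a / 2)
def isLt (a b : ℚ) : Comp n Bool := do tick (bits a + bits b); pure (decide (a < b))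
def isEq (a b : ℚ) : Comp n Bool := do tick (bits a + bits b); pure (decide (a = b))
/-- Convert a number to an index. -/
def toIndex (a : ℚ) : Comp n ℕ := do tick (bits a); pure ⌊a⌋.toNat

def readLo (v : Fin n) : Comp n ℚ := load bits (fun m => m.lo v)
def readHi (v : Fin n) : Comp n ℚ := load bits (fun m => m.hi v)
def readCtr (v : Fin n) : Comp n ℚ := load bits (fun m => m.ctr v)
def readF (v : Fin n) : Comp n (Option (Fin n)) := load (fun _ => 1) (fun m => m.f v)
def readG (v : Fin n) : Comp n (Option (Fin n)) := load (fun _ => 1) (fun m => m.g v)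
def readM (i j : Fin n) : Comp n Bool := load (fun _ => 1) (fun m => m.M i j)
def readBucket (k : ℕ) : Comp n (List (Fin n)) :=
  load (fun l => l.length + 1) (fun m => m.bucket k)
def readNodes (k : ℕ) : Comp n (List TypeList) :=
  load (fun l => l.length + 1) (fun m => m.nodes k)
def readBack (k : ℕ) (T : TypeList) : Comp n (List TypeList) :=
  load (fun l => l.length + 1) (fun m => m.back k T)

def writeLo (v : Fin n) (q : ℚ) : Comp n Unit :=
  store (bits q) (fun m => { m with lo := Function.update m.lo v q })
def writeHi (v : Fin n) (q : ℚ) : Comp n Unit :=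
  store (bits q) (fun m => { m with hi := Function.update m.hi v q })
def writeCtr (v : Fin n) (q : ℚ) : Comp n Unit :=
  store (bits q) (fun m => { m with ctr := Function.update m.ctr v q })
def writeTyp (v : Fin n) (τ : IType) : Comp n Unit :=
  store 1 (fun m => { m with typ := Function.update m.typ v (some τ) })
def writeF (v : Fin n) (w : Option (Fin n)) : Comp n Unit :=
  store 1 (fun m => { m with f := Function.update m.f v w })
def writeG (v : Fin n) (w : Option (Fin n)) : Comp n Unit :=
  store 1 (fun m => { m with g := Function.update m.g v w })
def writeM (i j : Fin n) (b : Bool) : Comp n Unit :=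
  store 1 (fun m => { m with M := Function.update m.M i (Function.update (m.M i) j b) })
def clearBucket (k : ℕ) : Comp n Unit :=
  store 1 (fun m => { m with bucket := Function.update m.bucket k [] })
/-- Append an element to the list of bucket `k`. -/
def pushBucket (k : ℕ) (v : Fin n) : Comp n Unit :=
  store 1 (fun m => { m with bucket := Function.update m.bucket k (m.bucket k ++ [v]) })
/-- Set the list of nodes at position `k`. -/
def writeNodes (k : ℕ) (Ts : List TypeList) : Comp n Unit :=
  store (Ts.length + 1) (fun m => { m with nodes := Function.update m.nodes k Ts })
/-- Create nodes at position `k` for all type assignments of length `t`, without pointers. -/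
def createNodes (S : Finset IType) (k t : ℕ) : Comp n Unit :=
  store (((arrangements (letters S) t).length + 1) * (t + 1)) (fun m =>
    { m with
      nodes := Function.update m.nodes k (arrangements (letters S) t)
      back := Function.update m.back k (fun _ => [])
      fwd := Function.update m.fwd k (fun _ => []) })
/-- Add a forward pointer from node `T₁` at `k` to node `T₂` at `k + 1`, and a pointer back. -/
def addPointers (k : ℕ) (T₁ T₂ : TypeList) : Comp n Unit :=
  store 2 (fun m => { m with
    fwd := Function.update m.fwd k
      (Function.update (m.fwd k) T₁ (T₂ :: m.fwd k T₁))
    back := Function.update m.back (k + 1)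
      (Function.update (m.back (k + 1)) T₂ (T₁ :: m.back (k + 1) T₂)) })

/-- Choose an entry of a list; `none` if the list is empty. -/
def pick (l : List α) : Comp n (Option α) := do
  let i ← load (fun _ => l.length + 1) (fun m => m.choices m.clock % l.length)
  store 0 (fun m => { m with clock := m.clock + 1 })
  pure l[i]?

/-- Execute `body` for all entries of a list, in order. -/
def forEach : List α → (α → Comp n Unit) → Comp n Unit
  | [], _ => tick 1
  | x :: xs, body => do
    tick 1
    body x
    forEach xs body

/-- Update an accumulator along a list. -/
def fold (body : β → α → Comp n β) : β → List α → Comp n β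
  | b, [] => do
    tick 1
    pure b
  | b, x :: xs => do
    tick 1
    let b' ← body b x
    fold body b' xs

/-- Concatenate the lists that `body` returns for the entries of a list. -/
def collect : List α → (α → Comp n (List β)) → Comp n (List β)
  | [], _ => do
    tick 1
    pure []
  | x :: xs, body => do
    tick 1
    let l ← body x
    let l' ← collect xs body
    tick l.length
    pure (l ++ l')

/-- Test the entries of a list until a test fails. -/
def allOf : List α → (α → Comp n Bool) → Comp n Bool
  | [], _ => do
    tick 1
    pure true
  | x :: xs, test => do
    tick 1
    let b ← test x
    if b then allOf xs test else pure false

/-- At most `k` rounds of the loop with body `body`; see `loop`. -/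
def loopFor (body : β → Comp n (β ⊕ α)) : ℕ → β → Comp n α
  | 0, _ => fun _ => none
  | k + 1, b => do
    tick 1
    let r ← body b
    match r with
    | .inl b' => loopFor body k b'
    | .inr a => pure a

/-- Repeat `body` until it returns `Sum.inr`.  Each round takes time, so the number of rounds is at
most the time left, and the bound in `loopFor` is no restriction. -/
def loop (body : β → Comp n (β ⊕ α)) (b : β) : Comp n α := fun s => loopFor body s.2 b s

end Primitives

/-! ### The algorithm

`lt` is the table of the order: `lt i j = true` if and only if element `i` is below element `j`.
-/

section Algorithm

variable {n : ℕ} (lt : Fin n → Fin n → Bool) (S : Finset IType)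

/-- If `ℓ(j) < ℓ(i) + d`, increase `ℓ(j)` to `ℓ(i) + d` and set `f(j) = i`.
Returns whether a change was made. -/
def raiseLo (i j : Fin n) (d : ℚ) : Comp n Bool := do
  let a ← readLo i
  let b ← readLo j
  let q ← add a d
  let c ← isLt b q
  if c then do
    writeLo j q
    writeF j (some i)
    pure true
  else pure false

/-- If `u(j) > u(i) + d`, decrease `u(j)` to `u(i) + d` and set `g(j) = i`.
Returns whether a change was made. -/
def lowerHi (i j : Fin n) (d : ℚ) : Comp n Bool := do
  let a ← readHi i
  let b ← readHi j
  let q ← add a d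
  let c ← isLt q b
  if c then do
    writeHi j q
    writeG j (some i)
    pure true
  else pure false

/-- Procedure Narrowing Steps for the pair `(i, j)`, `i ≠ j`.  Returns whether `ℓ(j)` or `u(j)`
was changed. -/
def narrow (i j : Fin n) : Comp n Bool := do
  tick 2
  if lt i j then raiseLo i j 1
  else if lt j i then lowerHi i j (-1)
  else do
    let b₁ ← raiseLo i j (-1)
    let b₂ ← lowerHi i j 1
    pure (b₁ || b₂)

/-- Start of a pass with starting element `v₀` and remaining active elements `vs`: reset `f`, `g`
and `M`, and run the narrowing steps for the pairs `(v₀, j)`. -/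
def startPass (v₀ : Fin n) (vs : List (Fin n)) : Comp n Unit := do
  forEach vs fun j => do
    writeF j none
    writeG j none
  forEach vs fun i => forEach vs fun j => writeM i j (decide (i = j))
  forEach vs fun j => do
    let _ ← narrow lt v₀ j
    pure ()

/-- All pairs `(i, j)` of entries of `vs` with `M i j = 0`. -/
def zeroPairs (vs : List (Fin n)) : Comp n (List (Fin n × Fin n)) :=
  collect vs fun i => collect vs fun j => do
    let b ← readM i j
    pure (if b then [] else [(i, j)])

/-- Set the nondiagonal entries of row `j` and column `j` of `M` to 0. -/
def resetM (vs : List (Fin n)) (j : Fin n) : Comp n Unit :=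
  forEach vs fun k =>
    if k = j then pure ()
    else do
      writeM j k false
      writeM k j false

/-- The labeling loop.  The result is `none` if the loop is left because all entries of `M` are 1,
and `some j` if `ℓ(j) > u(j)` was found. -/
def labelingLoop (vs : List (Fin n)) : Comp n (Option (Fin n)) :=
  loop (fun _ : Unit => do
    let zs ← zeroPairs vs
    let p ← pick zs
    match p with
    | none => pure (Sum.inr none)
    | some (i, j) => do
      let changed ← narrow lt i j
      let l ← readLo j
      let u ← readHi j
      let bad ← isLt u l
      if bad then pure (Sum.inr (some j))
      else if changed then do
        resetM vs j
        pure (Sum.inl ())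
      else do
        writeM i j true
        pure (Sum.inl ())) ()

/-! #### Procedure Assign Types -/

/-- Type assignments `T₁` at position `k` and `T₂` at position `k + 1` are compatible: the assigned
intervals represent the order on the elements at these positions.  (The centers are shifted to 0
and 1, which does not affect the precedence rule.) -/
def compatible (k : ℕ) (T₁ T₂ : TypeList) : Comp n Bool := do
  let b₁ ← readBucket k
  let b₂ ← readBucket (k + 1)
  tick (b₁.length + b₂.length)
  let l : List (Fin n × Interval) :=
    (b₁.zip T₁).map (fun p => (p.1, ⟨0, p.2⟩)) ++ (b₂.zip T₂).map (fun p => (p.1, ⟨1, p.2⟩))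
  allOf l fun p => allOf l fun q => do
    tick 1
    pure (lt p.1 q.1 == Interval.prec p.2 q.2)

/-- Set the pointers between the nodes at positions `k` and `k + 1`, and delete the nodes at
`k + 1` without backward pointers.  Returns whether a node at `k + 1` remains. -/
def linkNodes (k : ℕ) : Comp n Bool := do
  let N₁ ← readNodes k
  let N₂ ← readNodes (k + 1)
  forEach N₁ fun T₁ => forEach N₂ fun T₂ => do
    let ok ← compatible lt k T₁ T₂
    if ok then addPointers k T₁ T₂ else pure ()
  let N ← collect N₂ fun T => do
    let B ← readBack (k + 1) T
    pure (if B.isEmpty then [] else [T])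
  writeNodes (k + 1) N
  pure (!N.isEmpty)

/-- Give the elements at position `k` the types listed in `T`. -/
def setTypes (k : ℕ) (T : TypeList) : Comp n Unit := do
  let b ← readBucket k
  forEach (b.zip T) fun p => writeTyp p.1 p.2

/-- Follow backward pointers from node `T` at position `k` and set the types on the way. -/
def traceBack : ℕ → TypeList → Comp n Unit
  | 0, T => setTypes 0 T
  | k + 1, T => do
    setTypes (k + 1) T
    let B ← readBack (k + 1) T
    let T' ← pick B
    match T' with
    | none => pure ()
    | some T' => traceBack k T'

/-- Set the centers of the elements of `X` (which contains `v₀`) and run Procedure Assign Types.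
The result is `false` if there is no representation with these centers. -/
def assignTypes (v₀ : Fin n) (X : List (Fin n)) : Comp n Bool := do
  forEach X fun x => do
    let q ← readLo x
    writeCtr x q
  let c₀ ← readCtr v₀
  let low ← fold (fun a x => do
    let q ← readCtr x
    let b ← isLt q a
    pure (if b then q else a)) c₀ X
  let high ← fold (fun a x => do
    let q ← readCtr x
    let b ← isLt a q
    pure (if b then q else a)) c₀ X
  let d ← sub high low
  let K ← toIndex d
  forEach (List.range (K + 1)) fun k => clearBucket k
  forEach X fun x => do
    let q ← readCtr x
    let e ← sub q low
    let k ← toIndex e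
    pushBucket k x
  let small ← allOf (List.range (K + 1)) fun k => do
    let b ← readBucket k
    pure (decide (b.length ≤ S.card))
  if small then do
    forEach (List.range (K + 1)) fun k => do
      let b ← readBucket k
      createNodes S k b.length
    let ok ← allOf (List.range K) fun k => linkNodes lt k
    if ok then do
      let N ← readNodes K
      let T ← pick N
      match T with
      | none => pure false
      | some T => do
        traceBack K T
        pure true
    else pure false
  else pure false

/-! #### Certificates -/

/-- Follow the pointers `next` from `v` until `v₀`, nil or a repeated element is reached, for at
most `k` rounds; `acc` lists the elements passed, the most recent one first. -/
def trail (next : Fin n → Comp n (Option (Fin n))) (v₀ : Fin n) :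
    ℕ → Fin n → List (Fin n) → Comp n (List (Fin n))
  | 0, v, acc => do
    tick 1
    pure (v :: acc)
  | k + 1, v, acc => do
    tick (acc.length + 2)
    if v = v₀ ∨ v ∈ acc then pure (v :: acc)
    else do
      let w ← next v
      match w with
      | none => pure (v :: acc)
      | some w => trail next v₀ k w (v :: acc)

/-- Walk on along the given list from `prev`, where `val` is the value of the forcing trail walked
so far from `x` and `acc` this trail reversed, until `x` is reached with a positive value. -/
def scanPositive (x : Fin n) :
    Fin n → ℤ → List (Fin n) → List (Fin n) → Comp n (Option (List (Fin n)))
  | _, _, _, [] => do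
    tick 1
    pure none
  | prev, val, acc, y :: ys => do
    tick 2
    let val' := if lt prev y then val + 1 else val - 1
    if y = x ∧ 0 < val' then do
      tick (acc.length + 1)
      pure (some (y :: acc).reverse)
    else scanPositive x y val' (y :: acc) ys

/-- The first closed part with positive value of a forcing trail. -/
def findPositive : List (Fin n) → Comp n (List (Fin n))
  | [] => do
    tick 1
    pure []
  | x :: xs => do
    tick 1
    let r ← scanPositive lt x x 0 [x] xs
    match r with
    | some C => pure C
    | none => findPositive xs

/-- A forcing cycle with positive value, found by tracing `f` and `g` from an element `v` with
`ℓ(v) > u(v)`. -/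
def positiveCycle (v₀ v : Fin n) : Comp n (List (Fin n)) := do
  let a ← trail readF v₀ n v []
  let b ← trail readG v₀ n v []
  tick (a.length + b.length)
  findPositive lt (a ++ b.reverse.tail)

/-- A forcing cycle through `v₀` and the elements of `X`, found by tracing `f` and `g` from each
element of `X`. -/
def zeroCycle (v₀ : Fin n) (X : List (Fin n)) : Comp n (List (Fin n)) := do
  let C ← collect X fun x => do
    let a ← trail readF v₀ n x []
    let b ← trail readG v₀ n x []
    tick (a.length + b.length)
    pure (a.tail ++ b.reverse.tail)
  tick 1
  pure (v₀ :: C)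

/-! #### The main algorithm -/

/-- The possible outcomes: a representation (held by the arrays `ctr` and `typ` of the memory),
a forcing cycle with positive value, or a forcing cycle with value 0 for which Procedure Assign
Types fails. -/
inductive Outcome (n : ℕ) where
  | representation
  | positive (cycle : List (Fin n))
  | zero (cycle : List (Fin n))

/-- One pass.  The state is the starting element `v₀`, the list of the other active elements, and
the number `1 / 2 ^ r`, in pass `r`. -/
def pass (s : Fin n × List (Fin n) × ℚ) :
    Comp n ((Fin n × List (Fin n) × ℚ) ⊕ Outcome n) := do
  let v₀ := s.1
  let vs := s.2.1
  startPass lt v₀ vs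
  let res ← labelingLoop lt vs
  match res with
  | some v => do
    let C ← positiveCycle lt v₀ v
    pure (Sum.inr (Outcome.positive C))
  | none => do
    let X ← collect vs fun x => do
      let l ← readLo x
      let u ← readHi x
      let b ← isEq l u
      pure (if b then [x] else [])
    let rest ← collect vs fun x => do
      let l ← readLo x
      let u ← readHi x
      let b ← isEq l u
      pure (if b then [] else [x])
    let ok ← assignTypes lt S v₀ (v₀ :: X)
    if ok then do
      let w ← pick rest
      match w with
      | none => pure (Sum.inr Outcome.representation)
      | some w => do
        let ε ← halve s.2.2
        let l ← readLo w
        let c ← add l ε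
        writeLo w c
        writeHi w c
        let rest' ← collect rest fun x => pure (if x = w then [] else [x])
        pure (Sum.inl (w, rest', ε))
    else do
      let C ← zeroCycle v₀ X
      pure (Sum.inr (Outcome.zero C))

/-- Algorithm Recognize `S`-Orders. -/
def recognize : Comp n (Outcome n) := do
  let all := List.finRange n
  tick n
  let v ← pick all
  match v with
  | none => pure Outcome.representation
  | some v₀ => do
    forEach all fun x => do
      writeLo x (-(n : ℚ) - 1)
      writeHi x ((n : ℚ) + 1)
    writeLo v₀ 0
    writeHi v₀ 0
    let vs ← collect all fun x => pure (if x = v₀ then [] else [x])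
    loop (pass lt S) (v₀, vs, 1)

end Algorithm

end SOrder

/-! The bound is an amortized count. A round of the labeling loop scans `M` in time O(n²); the
arithmetic in it costs only O(n), because in pass r every label is a multiple of 1/2^n of absolute
value O(n), hence has O(n) digits (`Tame.bits_le`). So it suffices to show that all passes together
have O(n³) rounds and that the rest of each pass costs O(n⁴).

A round without a label change turns a 0 of `M` into a 1. A round with a change that does not end
the algorithm creates at most 2n new zeros. If a quantity `slack` drops by at least 1 at each such
change, then the number of zeros plus (2n+1) times the total slack bounds the rounds. Each pass
contributes at most n² initial zeros, so n³ over all passes, and it remains to bound the total slack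
by O(n²) for the whole run, not for each pass separately.

The difficulty is that labels from earlier passes may have other fractional parts, so that changes
could be tiny. The key point is that when a pass ends, all narrowing steps between active elements
are without effect. Hence in the next pass only labels in the class c + ℤ of the new starting label
c can cause a change (`Active.lo_step`, `Active.hi_step`), and a changed label enters this class. A
label in the class moves by at least 1 at each further change; the first change of a label outside
it is paid for by one extra unit, the term `off` in the slack (`lo_drop`, `hi_drop`). Passing to a
new c raises each element's slack by at most 2 (`slack_change`), so O(n) per pass. Initially each
slack is 2n+2, and the total over the run is O(n²).

Formally, `loop_exec` is the potential method. The inner loop returns the unused slack as credit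
(`labelingLoop_exec`), and the outer potential `timeLeft` also prepays the slack that later passes
create (`pass_exec`). -/

namespace SOrder

/-! ### Cost calculus for the machine -/

section Logic

variable {n : ℕ} {α β : Type}

/-- On memory `m`, the computation `c` takes `k` units of time, returns `a` and leaves `m'`. -/
def Runs (c : Comp n α) (m : Mem n) (a : α) (m' : Mem n) (k : ℕ) : Prop :=
  ∀ t, k ≤ t → c (m, t) = some (a, (m', t - k))

/-- On memory `m`, the computation `c` terminates, and result, final memory and time satisfy `Q`. -/
def Exec (c : Comp n α) (m : Mem n) (Q : α → Mem n → ℕ → Prop) : Prop :=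
  ∃ a m' k, Runs c m a m' k ∧ Q a m' k

/-- On memory `m`, the computation `c` takes at most `T` units of time, and the result and the final
memory satisfy `Q`. -/
def Cost (c : Comp n α) (m : Mem n) (T : ℕ) (Q : α → Mem n → Prop) : Prop :=
  Exec c m fun a m' k => k ≤ T ∧ Q a m'

theorem Runs.pure (a : α) (m : Mem n) : Runs (pure a) m a m 0 := fun _ _ => rfl

theorem Runs.bind {c : Comp n α} {f : α → Comp n β} {m m' m'' : Mem n} {a : α} {b : β} {k k' : ℕ}
    (h : Runs c m a m' k) (h' : Runs (f a) m' b m'' k') : Runs (c >>= f) m b m'' (k + k') := by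
  intro t ht
  show StateT.bind c f (m, t) = _
  have h1 := h t (by omega)
  have h2 := h' (t - k) (by omega)
  simp only [StateT.bind, h1]
  rw [Nat.sub_add_eq]
  exact h2

theorem Exec.bind {c : Comp n α} {f : α → Comp n β} {m : Mem n} {Q : α → Mem n → ℕ → Prop}
    {R : β → Mem n → ℕ → Prop} (h : Exec c m Q)
    (h' : ∀ a m' k, Q a m' k → Exec (f a) m' fun b m'' k' => R b m'' (k + k')) :
    Exec (c >>= f) m R := by
  obtain ⟨a, m', k, hr, hq⟩ := h
  obtain ⟨b, m'', k', hr', hq'⟩ := h' a m' k hq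
  exact ⟨b, m'', k + k', hr.bind hr', hq'⟩

theorem Exec.imp {c : Comp n α} {m : Mem n} {Q R : α → Mem n → ℕ → Prop} (h : Exec c m Q)
    (h' : ∀ a m' k, Q a m' k → R a m' k) : Exec c m R := by
  obtain ⟨a, m', k, hr, hq⟩ := h
  exact ⟨a, m', k, hr, h' _ _ _ hq⟩

theorem Cost.imp {c : Comp n α} {m : Mem n} {T T' : ℕ} {Q R : α → Mem n → Prop}
    (h : Cost c m T Q) (hT : T ≤ T') (h' : ∀ a m', Q a m' → R a m') : Cost c m T' R :=
  Exec.imp h fun _ _ _ hq => ⟨hq.1.trans hT, h' _ _ hq.2⟩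

theorem Cost.mono {c : Comp n α} {m : Mem n} {T T' : ℕ} {Q : α → Mem n → Prop}
    (h : Cost c m T Q) (hT : T ≤ T') : Cost c m T' Q :=
  h.imp hT fun _ _ h => h

theorem Cost.pure {a : α} {m : Mem n} {T : ℕ} {Q : α → Mem n → Prop} (h : Q a m) :
    Cost (pure a) m T Q := ⟨a, m, 0, Runs.pure a m, Nat.zero_le _, h⟩

theorem Cost.bind {c : Comp n α} {f : α → Comp n β} {m : Mem n} {T T₁ : ℕ} {Q : α → Mem n → Prop}
    {R : β → Mem n → Prop} (h : Cost c m T₁ Q)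
    (h' : ∀ a m', Q a m' → Cost (f a) m' (T - T₁) R) (hT : T₁ ≤ T := by omega) :
    Cost (c >>= f) m T R := by
  refine Exec.bind h fun a m' k hq => Exec.imp (h' a m' hq.2) fun b m'' k' hk => ⟨?_, hk.2⟩
  have := hq.1
  have := hk.1
  omega

theorem Cost.ite {p : Prop} [Decidable p] {c d : Comp n α} {m : Mem n} {T : ℕ}
    {Q : α → Mem n → Prop} (h : p → Cost c m T Q) (h' : ¬p → Cost d m T Q) :
    Cost (if p then c else d) m T Q := by
  split
  · exact h ‹_›
  · exact h' ‹_›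

theorem Cost.tick {m : Mem n} (c : ℕ) : Cost (tick c) m c fun _ m' => m' = m := by
  refine ⟨(), m, c, fun t ht => ?_, le_rfl, rfl⟩
  simp [SOrder.tick, ht]

theorem Cost.load {m : Mem n} (cost : α → ℕ) (h : Mem n → α) :
    Cost (load cost h) m (cost (h m)) fun a m' => a = h m ∧ m' = m := by
  refine Exec.imp (c := do SOrder.tick (cost (h m)); Pure.pure (h m)) ?_ fun _ _ _ h => h
  exact Cost.bind (Cost.tick _) (by rintro _ _ rfl; exact Cost.pure ⟨rfl, rfl⟩)

theorem Cost.store {m : Mem n} (c : ℕ) (h : Mem n → Mem n) :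
    Cost (store c h) m c fun _ m' => m' = h m := by
  refine Exec.imp (c := do SOrder.tick c; fun s' => some ((), (h s'.1, s'.2))) ?_ fun _ _ _ h => h
  refine Cost.bind (Cost.tick _) ?_
  rintro _ _ rfl
  exact ⟨(), _, 0, fun _ _ => rfl, Nat.zero_le _, rfl⟩

theorem Cost.add {m : Mem n} (a b : ℚ) :
    Cost (add a b) m (bits a + bits b) fun q m' => q = a + b ∧ m' = m :=
  Cost.bind (Cost.tick _) (by rintro _ _ rfl; exact Cost.pure ⟨rfl, rfl⟩)

theorem Cost.sub {m : Mem n} (a b : ℚ) :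
    Cost (sub a b) m (bits a + bits b) fun q m' => q = a - b ∧ m' = m :=
  Cost.bind (Cost.tick _) (by rintro _ _ rfl; exact Cost.pure ⟨rfl, rfl⟩)

theorem Cost.halve {m : Mem n} (a : ℚ) :
    Cost (halve a) m (bits a) fun q m' => q = a / 2 ∧ m' = m :=
  Cost.bind (Cost.tick _) (by rintro _ _ rfl; exact Cost.pure ⟨rfl, rfl⟩)

theorem Cost.isLt {m : Mem n} (a b : ℚ) :
    Cost (isLt a b) m (bits a + bits b) fun q m' => q = decide (a < b) ∧ m' = m :=
  Cost.bind (Cost.tick _) (by rintro _ _ rfl; exact Cost.pure ⟨rfl, rfl⟩)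

theorem Cost.isEq {m : Mem n} (a b : ℚ) :
    Cost (isEq a b) m (bits a + bits b) fun q m' => q = decide (a = b) ∧ m' = m :=
  Cost.bind (Cost.tick _) (by rintro _ _ rfl; exact Cost.pure ⟨rfl, rfl⟩)

theorem Cost.toIndex {m : Mem n} (a : ℚ) :
    Cost (toIndex a) m (bits a) fun q m' => q = ⌊a⌋.toNat ∧ m' = m :=
  Cost.bind (Cost.tick _) (by rintro _ _ rfl; exact Cost.pure ⟨rfl, rfl⟩)

theorem Cost.pick {m : Mem n} (l : List α) :
    Cost (pick l) m (l.length + 1) fun a m' =>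
      (a = none → l = []) ∧ (∀ x, a = some x → x ∈ l) ∧ m' = { m with clock := m.clock + 1 } := by
  refine Cost.bind (Cost.load _ _) ?_
  rintro _ _ ⟨rfl, rfl⟩
  refine Cost.bind (Cost.store _ _) ?_
  rintro _ _ rfl
  refine Cost.pure ⟨fun h => ?_, fun x h => List.mem_of_getElem? h, rfl⟩
  by_contra hl
  rw [List.getElem?_eq_none_iff] at h
  exact absurd h (not_le.2 (Nat.mod_lt _ (List.length_pos_of_ne_nil hl)))

/-- The invariant is indexed by the entries still to come, so that it can speak of what has already
been processed. -/
theorem Cost.forEach {body : α → Comp n Unit} {T : ℕ} (I : List α → Mem n → Prop) :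
    ∀ {l : List α} {m : Mem n},
      (∀ x rest m, x ∈ l → I (x :: rest) m → Cost (body x) m T fun _ m' => I rest m') →
      I l m → Cost (forEach l body) m (l.length * (T + 1) + 1) fun _ m' => I [] m'
  | [], m, _, h => (Cost.tick 1).imp (by simp) (by rintro _ _ rfl; exact h)
  | x :: xs, m, hb, h => by
    have e : (x :: xs).length * (T + 1) + 1 = 1 + T + (xs.length * (T + 1) + 1) := by
      simp only [List.length_cons]; ring
    rw [e]
    refine Cost.bind (Cost.tick 1) ?_
    rintro _ _ rfl
    refine Cost.bind (hb x xs _ (by simp) h) fun _ m' h' => ?_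
    exact (Cost.forEach I (fun y rest m hy => hb y rest m (by simp [hy])) h').mono (by omega)

theorem Cost.forEach_const {body : α → Comp n Unit} {T : ℕ} (I : Mem n → Prop) {l : List α}
    {m : Mem n} (hb : ∀ x m, x ∈ l → I m → Cost (body x) m T fun _ m' => I m') (h : I m) :
    Cost (SOrder.forEach l body) m (l.length * (T + 1) + 1) fun _ m' => I m' :=
  Cost.forEach (fun _ => I) (fun x _ m hx => hb x m hx) h

theorem Cost.fold {body : β → α → Comp n β} {T : ℕ} (I : β → Prop) {m : Mem n} :
    ∀ {l : List α} {b : β},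
      (∀ b x, x ∈ l → I b → Cost (body b x) m T fun b' m' => I b' ∧ m' = m) →
      I b → Cost (fold body b l) m (l.length * (T + 1) + 1) fun b' m' => I b' ∧ m' = m
  | [], b, _, h => Cost.bind (Cost.tick 1) (by rintro _ _ rfl; exact Cost.pure ⟨h, rfl⟩) (by simp)
  | x :: xs, b, hb, h => by
    have e : (x :: xs).length * (T + 1) + 1 = 1 + T + (xs.length * (T + 1) + 1) := by
      simp only [List.length_cons]; ring
    rw [e]
    refine Cost.bind (Cost.tick 1) ?_
    rintro _ _ rfl
    refine Cost.bind (hb b x (by simp) h) ?_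
    rintro b' _ ⟨h', rfl⟩
    exact (Cost.fold I (fun b y hy => hb b y (by simp [hy])) h').mono (by omega)

/-- For read-only bodies: the memory never changes, so each result is a fixed function `r` of the
entry. The `p` per entry pays for concatenation. -/
theorem Cost.collect {body : α → Comp n (List β)} {T p : ℕ} (r : α → List β) {m : Mem n} :
    ∀ {l : List α},
      (∀ x, x ∈ l → (r x).length ≤ p ∧ Cost (body x) m T fun a m' => a = r x ∧ m' = m) →
      Cost (collect l body) m (l.length * (T + p + 1) + 1) fun a m' => a = l.flatMap r ∧ m' = m
  | [], _ => Cost.bind (Cost.tick 1) (by rintro _ _ rfl; exact Cost.pure ⟨rfl, rfl⟩) (by simp)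
  | x :: xs, hb => by
    have e : (x :: xs).length * (T + p + 1) + 1 = 1 + T + (xs.length * (T + p + 1) + 1) + p := by
      simp only [List.length_cons]; ring
    rw [e]
    refine Cost.bind (Cost.tick 1) ?_
    rintro _ _ rfl
    refine Cost.bind (hb x (by simp)).2 ?_
    rintro _ _ ⟨rfl, rfl⟩
    refine Cost.bind (Cost.collect r fun y hy => hb y (by simp [hy])) ?_
    rintro _ _ ⟨rfl, rfl⟩
    have := (hb x (by simp)).1
    refine Cost.bind (Cost.tick _) ?_
    rintro _ _ rfl
    exact Cost.pure ⟨by simp, rfl⟩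

theorem length_flatMap_le {p : ℕ} {r : α → List β} :
    ∀ {l : List α}, (∀ x ∈ l, (r x).length ≤ p) → (l.flatMap r).length ≤ l.length * p
  | [], _ => by simp
  | x :: xs, h => by
    have h1 := h x (by simp)
    have h2 := length_flatMap_le (l := xs) fun y hy => h y (by simp [hy])
    simp only [List.flatMap_cons, List.length_append, List.length_cons]
    linarith [Nat.succ_mul xs.length p]

/-- The remaining list is existentially quantified in the conclusion because a failing test stops
the iteration early. -/
theorem Cost.allOf {test : α → Comp n Bool} {T : ℕ} (I : List α → Mem n → Prop) (p : α → Prop) :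
    ∀ {l : List α} {m : Mem n},
      (∀ x rest m, x ∈ l → I (x :: rest) m →
        Cost (test x) m T fun b m' => I rest m' ∧ (b = true → p x)) →
      I l m → Cost (allOf l test) m (l.length * (T + 1) + 1) fun b m' =>
        (∃ rest, I rest m') ∧ (b = true → ∀ x ∈ l, p x)
  | [], m, _, h => Cost.bind (Cost.tick 1)
      (by rintro _ _ rfl; exact Cost.pure ⟨⟨_, h⟩, by simp⟩) (by simp)
  | x :: xs, m, hb, h => by
    have e : (x :: xs).length * (T + 1) + 1 = 1 + T + (xs.length * (T + 1) + 1) := by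
      simp only [List.length_cons]; ring
    rw [e]
    refine Cost.bind (Cost.tick 1) ?_
    rintro _ _ rfl
    refine Cost.bind (hb x xs _ (by simp) h) ?_
    rintro b m' ⟨h', hp⟩
    refine Cost.ite (fun hb' => ?_) fun hb' => Cost.pure ⟨⟨_, h'⟩, by simp⟩
    refine (Cost.allOf I p (fun y rest m hy => hb y rest m (by simp [hy])) h').imp (by omega) ?_
    rintro b m' ⟨h1, h2⟩
    exact ⟨h1, fun hb'' => by simpa [hp hb'] using h2 hb''⟩

theorem bind_apply {c : Comp n α} {f : α → Comp n β} {s s' : Mem n × ℕ} {a : α}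
    (h : c s = some (a, s')) : (c >>= f) s = f a s' := by
  show StateT.bind c f s = _
  simp only [StateT.bind, h]
  rfl

theorem tick_apply {m : Mem n} {c t : ℕ} (h : c ≤ t) : tick c (m, t) = some ((), (m, t - c)) := by
  simp [tick, h]

/-- Potential method: each round is paid for by a drop of `μ`, the extra 1 being the tick of the
loop. The part `E` of the potential that is unspent at exit is handed back, so that nested loops can
be amortized together. -/
theorem loop_exec {body : β → Comp n (β ⊕ α)} (I : β → Mem n → Prop) (μ : β → Mem n → ℕ)
    {Q : α → Mem n → Prop} (E : α → Mem n → ℕ)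
    (hb : ∀ b m, I b m → Exec (body b) m fun r m' k => match r with
      | .inl b' => I b' m' ∧ k + 1 + μ b' m' ≤ μ b m
      | .inr a => Q a m' ∧ k + 1 + E a m' ≤ μ b m)
    {b : β} {m : Mem n} (h : I b m) :
    Exec (loop body b) m fun a m' k => Q a m' ∧ k + E a m' ≤ μ b m := by
  -- The bound `j` on the rounds is decoupled from the time `t`: each round ticks, so `k ≤ j` is
  -- enough for `loopFor` not to run out of rounds.
  suffices H : ∀ N b m, μ b m ≤ N → I b m → ∃ a m' k, (Q a m' ∧ k + E a m' ≤ μ b m) ∧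
      ∀ t j, k ≤ t → k ≤ j → loopFor body j b (m, t) = some (a, (m', t - k)) by
    obtain ⟨a, m', k, hq, hk⟩ := H _ b m le_rfl h
    exact ⟨a, m', k, fun t ht => hk t t ht ht, hq⟩
  intro N
  induction N with
  | zero =>
    intro b m hN h
    obtain ⟨r, m', k, -, hr⟩ := hb b m h
    cases r with
    | inl b' => have := hr.2; omega
    | inr b' => have := hr.2; omega
  | succ N ih =>
    intro b m hN h
    obtain ⟨r, m', k, hk, hr⟩ := hb b m h
    cases r with
    | inl b' =>
      obtain ⟨hi, hμ⟩ := hr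
      obtain ⟨a, m'', k', ⟨hq, hE⟩, hk'⟩ := ih b' m' (by omega) hi
      refine ⟨a, m'', 1 + (k + k'), ⟨hq, by omega⟩, fun t j ht hj => ?_⟩
      obtain ⟨j, rfl⟩ : ∃ i, j = i + 1 := ⟨j - 1, by omega⟩
      rw [loopFor, bind_apply (tick_apply (by omega)), bind_apply (hk (t - 1) (by omega))]
      refine (hk' (t - 1 - k) j (by omega) (by omega)).trans ?_
      rw [show t - 1 - k - k' = t - (1 + (k + k')) by omega]
    | inr a =>
      refine ⟨a, m', 1 + k, ⟨hr.1, by have := hr.2; omega⟩, fun t j ht hj => ?_⟩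
      obtain ⟨j, rfl⟩ : ∃ i, j = i + 1 := ⟨j - 1, by omega⟩
      rw [loopFor, bind_apply (tick_apply (by omega)), bind_apply (hk (t - 1) (by omega)),
        ← Nat.sub_sub]
      rfl

end Logic


/-! ### Digit lengths of the labels -/

section Numbers

/-- `q` is a multiple of `1 / 2 ^ n` of absolute value at most `B`. -/
def Tame (n B : ℕ) (q : ℚ) : Prop := (∃ z : ℤ, q * 2 ^ n = z) ∧ |q| ≤ B

variable {n B B' : ℕ} {p q : ℚ}

theorem Tame.mono (h : Tame n B q) (hB : B ≤ B') : Tame n B' q :=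
  ⟨h.1, h.2.trans (by exact_mod_cast hB)⟩

theorem Tame.add (hp : Tame n B p) (hq : Tame n B' q) : Tame n (B + B') (p + q) := by
  obtain ⟨⟨z, hz⟩, hp⟩ := hp
  obtain ⟨⟨w, hw⟩, hq⟩ := hq
  refine ⟨⟨z + w, ?_⟩, (abs_add_le _ _).trans ?_⟩
  · rw [add_mul, hz, hw]; push_cast; rfl
  · push_cast; linarith

theorem Tame.neg (hp : Tame n B p) : Tame n B (-p) := by
  obtain ⟨⟨z, hz⟩, hp⟩ := hp
  exact ⟨⟨-z, by rw [neg_mul, hz]; push_cast; rfl⟩, by rwa [abs_neg]⟩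

theorem Tame.sub (hp : Tame n B p) (hq : Tame n B' q) : Tame n (B + B') (p - q) := by
  rw [sub_eq_add_neg]; exact hp.add hq.neg

theorem tame_int (z : ℤ) (h : |z| ≤ B) : Tame n B z :=
  ⟨⟨z * 2 ^ n, by push_cast; rfl⟩, by exact_mod_cast h⟩

theorem Tame.of_le_of_le {a : ℚ} (ha : ∃ z : ℤ, a * 2 ^ n = z) (h1 : -(B : ℚ) ≤ a)
    (h2 : a ≤ B) : Tame n B a := ⟨ha, abs_le.2 ⟨h1, h2⟩⟩

/-- The reduced denominator divides 2^n, and the numerator is then at most 16n · 2^n < 2^(2n+4).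
With the sign bit this gives 3n + 6 ≤ 9n digits. -/
theorem Tame.bits_le (h : Tame n B q) (hB : B ≤ 16 * n) (hn : 1 ≤ n) : bits q ≤ 9 * n := by
  obtain ⟨⟨z, hz⟩, hq⟩ := h
  have hden : q.den ≤ 2 ^ n := by
    have h1 : (q.num : ℚ) * 2 ^ n = z * q.den := by
      rw [← hz, mul_right_comm, Rat.mul_den_eq_num]
    have h2 : q.num * 2 ^ n = z * q.den := by exact_mod_cast h1
    have h3 : (q.den : ℤ) ∣ q.num * 2 ^ n := ⟨z, by rw [h2, mul_comm]⟩
    have h4 : q.den ∣ q.num.natAbs * 2 ^ n := by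
      have := Int.natAbs_dvd_natAbs.2 h3
      simpa [Int.natAbs_mul, Int.natAbs_pow] using this
    exact Nat.le_of_dvd (by positivity) (q.reduced.symm.dvd_of_dvd_mul_left h4)
  have hnum : q.num.natAbs < 2 ^ (2 * n + 4) := by
    have h1 : (q.num.natAbs : ℚ) = |q| * q.den := by
      rw [Nat.cast_natAbs, Int.cast_abs, ← Rat.mul_den_eq_num, abs_mul, Nat.abs_cast]
    have h2 : (q.num.natAbs : ℚ) ≤ (B * 2 ^ n : ℕ) := by
      rw [h1]; push_cast
      exact mul_le_mul hq (by exact_mod_cast hden) (by positivity) (by positivity)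
    have h3 : q.num.natAbs ≤ B * 2 ^ n := by exact_mod_cast h2
    calc q.num.natAbs ≤ B * 2 ^ n := h3
      _ ≤ (16 * n) * 2 ^ n := Nat.mul_le_mul_right _ hB
      _ < (16 * 2 ^ n) * 2 ^ n :=
        Nat.mul_lt_mul_of_pos_right (Nat.mul_lt_mul_of_pos_left n.lt_two_pow_self (by norm_num))
          (by positivity)
      _ = 2 ^ (2 * n + 4) := by ring
  have h1 : Nat.size q.num.natAbs ≤ 2 * n + 4 := Nat.size_le.2 hnum
  have h2 : Nat.size q.den ≤ n + 1 :=
    Nat.size_le.2 (hden.trans_lt (Nat.pow_lt_pow_right (by norm_num) (by omega)))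
  unfold bits
  omega

end Numbers

/-! ### Cost and effect of the narrowing steps -/

section Narrowing

variable {n B : ℕ} (lt : Fin n → Fin n → Bool)

/-- The labels of `v` are multiples of `1 / 2 ^ n` of absolute value at most `B`. -/
def TameAt (B : ℕ) (m : Mem n) (v : Fin n) : Prop := Tame n B (m.lo v) ∧ Tame n B (m.hi v)

/-- At 9n digits per number, seven operands are read, added, compared or written, which gives 63n,
and one more unit sets the pointer. -/
theorem raiseLo_cost {m : Mem n} {i j : Fin n} {z : ℤ} (hz : |z| ≤ 1) (hn : 1 ≤ n)
    (hB : B + 1 ≤ 16 * n) (hi : Tame n B (m.lo i)) (hj : Tame n B (m.lo j)) :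
    Cost (raiseLo i j z) m (64 * n) fun r m' => ∃ a f,
      m' = { m with lo := Function.update m.lo j a, f := f } ∧
      (r = true → a = m.lo i + z ∧ m.lo j < a) ∧ (r = false → a = m.lo j ∧ m.lo i + z ≤ a) := by
  have b1 := hi.bits_le (by omega) hn
  have b2 := hj.bits_le (by omega) hn
  have tz : Tame n 1 (z : ℚ) := tame_int z (by exact_mod_cast hz)
  have b3 := tz.bits_le (by omega) hn
  have b4 := (hi.add tz).bits_le hB hn
  unfold raiseLo
  refine Cost.bind (Cost.load _ _) ?_
  rintro _ _ ⟨rfl, rfl⟩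
  refine Cost.bind (Cost.load _ _) ?_
  rintro _ _ ⟨rfl, rfl⟩
  refine Cost.bind (Cost.add _ _) ?_
  rintro _ _ ⟨rfl, rfl⟩
  refine Cost.bind (Cost.isLt _ _) ?_
  rintro _ m ⟨rfl, rfl⟩
  refine Cost.ite (fun h => ?_) fun h => ?_
  · refine Cost.bind (Cost.store _ _) ?_
    rintro _ _ rfl
    refine Cost.bind (Cost.store _ _) ?_
    rintro _ _ rfl
    exact Cost.pure ⟨_, _, rfl, fun _ => ⟨rfl, by simpa using h⟩, by simp⟩
  · exact Cost.pure ⟨m.lo j, m.f, by simp, by simp, fun _ => ⟨rfl, by simpa using h⟩⟩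

theorem lowerHi_cost {m : Mem n} {i j : Fin n} {z : ℤ} (hz : |z| ≤ 1) (hn : 1 ≤ n)
    (hB : B + 1 ≤ 16 * n) (hi : Tame n B (m.hi i)) (hj : Tame n B (m.hi j)) :
    Cost (lowerHi i j z) m (64 * n) fun r m' => ∃ b g,
      m' = { m with hi := Function.update m.hi j b, g := g } ∧
      (r = true → b = m.hi i + z ∧ b < m.hi j) ∧ (r = false → b = m.hi j ∧ b ≤ m.hi i + z) := by
  have b1 := hi.bits_le (by omega) hn
  have b2 := hj.bits_le (by omega) hn
  have tz : Tame n 1 (z : ℚ) := tame_int z (by exact_mod_cast hz)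
  have b3 := tz.bits_le (by omega) hn
  have b4 := (hi.add tz).bits_le hB hn
  unfold lowerHi
  refine Cost.bind (Cost.load _ _) ?_
  rintro _ _ ⟨rfl, rfl⟩
  refine Cost.bind (Cost.load _ _) ?_
  rintro _ _ ⟨rfl, rfl⟩
  refine Cost.bind (Cost.add _ _) ?_
  rintro _ _ ⟨rfl, rfl⟩
  refine Cost.bind (Cost.isLt _ _) ?_
  rintro _ m ⟨rfl, rfl⟩
  refine Cost.ite (fun h => ?_) fun h => ?_
  · refine Cost.bind (Cost.store _ _) ?_
    rintro _ _ rfl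
    refine Cost.bind (Cost.store _ _) ?_
    rintro _ _ rfl
    exact Cost.pure ⟨_, _, rfl, fun _ => ⟨rfl, by simpa using h⟩, by simp⟩
  · exact Cost.pure ⟨m.hi j, m.g, by simp, by simp, fun _ => ⟨rfl, by simpa using h⟩⟩

/-- The narrowing steps for `(i, j)` require `ℓ(j) ≥ ℓ(i) + z`. -/
def LoEdge (i j : Fin n) (z : ℤ) : Prop :=
  (lt i j = true ∧ z = 1) ∨ (lt i j = false ∧ lt j i = false ∧ z = -1)

/-- The narrowing steps for `(i, j)` require `u(j) ≤ u(i) + z`. -/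
def HiEdge (i j : Fin n) (z : ℤ) : Prop :=
  (lt i j = false ∧ lt j i = true ∧ z = -1) ∨ (lt i j = false ∧ lt j i = false ∧ z = 1)

variable {lt} in
theorem LoEdge.abs_le {i j : Fin n} {z : ℤ} (h : LoEdge lt i j z) : |z| ≤ 1 := by
  rcases h with ⟨-, rfl⟩ | ⟨-, -, rfl⟩ <;> simp

variable {lt} in
theorem HiEdge.abs_le {i j : Fin n} {z : ℤ} (h : HiEdge lt i j z) : |z| ≤ 1 := by
  rcases h with ⟨-, -, rfl⟩ | ⟨-, -, rfl⟩ <;> simp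

/-- `a` is the value of `ℓ(j)` after the narrowing steps for `(i, j)`. -/
def LoStep (m : Mem n) (i j : Fin n) (a : ℚ) : Prop :=
  (a = m.lo j ∧ ∀ z, LoEdge lt i j z → m.lo i + z ≤ m.lo j) ∨
    (m.lo j < a ∧ ∃ z, LoEdge lt i j z ∧ a = m.lo i + z)

/-- `b` is the value of `u(j)` after the narrowing steps for `(i, j)`. -/
def HiStep (m : Mem n) (i j : Fin n) (b : ℚ) : Prop :=
  (b = m.hi j ∧ ∀ z, HiEdge lt i j z → m.hi j ≤ m.hi i + z) ∨
    (b < m.hi j ∧ ∃ z, HiEdge lt i j z ∧ b = m.hi i + z)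

theorem narrow_cost {m : Mem n} {i j : Fin n} (hn : 1 ≤ n) (hB : B + 1 ≤ 16 * n)
    (hi : TameAt B m i) (hj : TameAt B m j) :
    Cost (narrow lt i j) m (130 * n) fun r m' => ∃ a b f g,
      m' = { m with
        lo := Function.update m.lo j a, hi := Function.update m.hi j b, f := f, g := g } ∧
      LoStep lt m i j a ∧ HiStep lt m i j b ∧
      (r = true → m.lo j < a ∨ b < m.hi j) ∧ (r = false → a = m.lo j ∧ b = m.hi j) := by
  unfold narrow
  refine Cost.bind (Cost.tick 2) ?_
  rintro _ m rfl
  have e1 : (1 : ℚ) = ((1 : ℤ) : ℚ) := by norm_num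
  have e2 : (-1 : ℚ) = ((-1 : ℤ) : ℚ) := by norm_num
  -- The increments are turned into casts of integers, the form in which the two cost lemmas take
  -- them.
  rw [e2, e1]
  refine Cost.ite (fun h => ?_) fun h => Cost.ite (fun h' => ?_) fun h' => ?_
  · refine (raiseLo_cost (by simp) hn hB hi.1 hj.1).imp (by omega) ?_
    rintro r m' ⟨a, f, rfl, h1, h2⟩
    refine ⟨a, m.hi j, f, m.g, by simp, ?_, .inl ⟨rfl, ?_⟩, fun hr => .inl (h1 hr).2,
      fun hr => ⟨(h2 hr).1, rfl⟩⟩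
    · cases r with
      | true => exact .inr ⟨(h1 rfl).2, 1, .inl ⟨h, rfl⟩, (h1 rfl).1⟩
      | false =>
        obtain ⟨h3, h4⟩ := h2 rfl
        refine .inl ⟨h3, ?_⟩
        rintro z (⟨-, rfl⟩ | ⟨h5, -⟩)
        · rwa [← h3]
        · simp [h] at h5
    · rintro z (⟨h5, -⟩ | ⟨h5, -⟩) <;> simp [h] at h5
  · have h := Bool.eq_false_iff.2 h
    refine (lowerHi_cost (by simp) hn hB hi.2 hj.2).imp (by omega) ?_
    rintro r m' ⟨b, g, rfl, h1, h2⟩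
    refine ⟨m.lo j, b, m.f, g, by simp, .inl ⟨rfl, ?_⟩, ?_, fun hr => .inr (h1 hr).2,
      fun hr => ⟨rfl, (h2 hr).1⟩⟩
    · rintro z (⟨h5, -⟩ | ⟨-, h5, -⟩) <;> simp [h, h'] at h5
    · cases r with
      | true => exact .inr ⟨(h1 rfl).2, -1, .inl ⟨h, h', rfl⟩, (h1 rfl).1⟩
      | false =>
        obtain ⟨h3, h4⟩ := h2 rfl
        refine .inl ⟨h3, ?_⟩
        rintro z (⟨-, -, rfl⟩ | ⟨-, h5, -⟩)
        · rwa [← h3]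
        · simp [h'] at h5
  · have h := Bool.eq_false_iff.2 h
    have h' := Bool.eq_false_iff.2 h'
    refine Cost.bind (raiseLo_cost (by simp) hn hB hi.1 hj.1) ?_
    rintro r _ ⟨a, f, rfl, h1, h2⟩
    refine Cost.bind (lowerHi_cost (by simp) hn hB hi.2 hj.2) ?_
    rintro r' _ ⟨b, g, rfl, h1', h2'⟩
    refine Cost.pure ⟨a, b, f, g, rfl, ?_, ?_, ?_, ?_⟩
    · cases r with
      | true => exact .inr ⟨(h1 rfl).2, -1, .inr ⟨h, h', rfl⟩, (h1 rfl).1⟩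
      | false =>
        obtain ⟨h3, h4⟩ := h2 rfl
        refine .inl ⟨h3, ?_⟩
        rintro z (⟨h5, -⟩ | ⟨-, -, rfl⟩)
        · simp [h] at h5
        · rwa [← h3]
    · cases r' with
      | true => exact .inr ⟨(h1' rfl).2, 1, .inr ⟨h, h', rfl⟩, (h1' rfl).1⟩
      | false =>
        obtain ⟨h3, h4⟩ := h2' rfl
        refine .inl ⟨h3, ?_⟩
        rintro z (⟨-, h5, -⟩ | ⟨-, -, rfl⟩)
        · simp [h'] at h5
        · rwa [← h3]
    · intro hr
      rcases Bool.or_eq_true_iff.1 hr with hr | hr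
      · exact .inl (h1 hr).2
      · exact .inr (h1' hr).2
    · intro hr
      obtain ⟨hr, hr'⟩ := Bool.or_eq_false_iff.1 hr
      exact ⟨(h2 hr).1, (h2' hr').1⟩

end Narrowing


/-! ### Operations on the matrix `M` -/

section Matrix

variable {n : ℕ}

theorem update_update_apply {α β γ : Type*} [DecidableEq α] [DecidableEq β] (M : α → β → γ)
    (i p : α) (j q : β) (b : γ) :
    Function.update M i (Function.update (M i) j b) p q = if p = i ∧ q = j then b else M p q := by
  by_cases h : p = i
  · subst h
    by_cases h' : q = j <;> simp [h']
  · simp [h]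

/-- Two facts about the new matrix are kept: changes occur only in row and column `j`, which limits
the new zeros, and these are really cleared off the diagonal, which keeps every remaining 1
truthful. -/
theorem resetM_cost (vs : List (Fin n)) (j : Fin n) (m : Mem n) :
    Cost (resetM vs j) m (vs.length * 3 + 1) fun _ m' => ∃ M', m' = { m with M := M' } ∧
      (∀ p q, M' p q = m.M p q ∨ M' p q = false ∧ ((p = j ∧ q ∈ vs) ∨ (q = j ∧ p ∈ vs))) ∧
      ∀ k ∈ vs, k ≠ j → M' j k = false ∧ M' k j = false := by
  refine (Cost.forEach (T := 2) (fun rest m' => ∃ M', m' = { m with M := M' } ∧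
      (∀ p q, M' p q = m.M p q ∨ M' p q = false ∧ ((p = j ∧ q ∈ vs) ∨ (q = j ∧ p ∈ vs))) ∧
      ∀ k ∈ vs, k ∉ rest → k ≠ j → M' j k = false ∧ M' k j = false) ?_ ?_).imp le_rfl ?_
  · rintro x rest _ hx ⟨M', rfl, h1, h2⟩
    refine Cost.ite (fun h => ?_) fun h => ?_
    · refine Cost.pure ⟨M', rfl, h1, fun k hk hk' hkj => h2 k hk ?_ hkj⟩
      simp only [List.mem_cons, not_or]
      exact ⟨fun e => hkj (e.trans h), hk'⟩
    · refine Cost.bind (Cost.store 1 _) ?_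
      rintro _ _ rfl
      refine (Cost.store 1 _).imp (by omega) ?_
      rintro _ _ rfl
      refine ⟨_, rfl, fun p q => ?_, fun k hk hk' hkj => ?_⟩
      · simp only [update_update_apply]
        have := h1 p q
        grind
      · simp only [update_update_apply]
        have := h2 k hk
        grind
  · exact ⟨m.M, rfl, fun _ _ => .inl rfl, fun k hk hk' => absurd hk hk'⟩
  · rintro _ _ ⟨M', h, h1, h2⟩
    exact ⟨M', h, h1, fun k hk => h2 k hk (by simp)⟩

theorem initM_cost (vs : List (Fin n)) (hvs : vs.length ≤ n) (m : Mem n) :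
    Cost (forEach vs fun i => forEach vs fun j => writeM i j (decide (i = j))) m
      (n * (n * 2 + 2) + 1) fun _ m' => ∃ M', m' = { m with M := M' } ∧
        ∀ i ∈ vs, ∀ j ∈ vs, M' i j = true → i = j := by
  refine (Cost.forEach (T := n * 2 + 1) (fun rest m' => ∃ M', m' = { m with M := M' } ∧
    ∀ i ∈ vs, i ∉ rest → ∀ j ∈ vs, M' i j = true → i = j) ?_ ?_).imp
    (by gcongr) ?_
  · rintro i rest _ hi ⟨M', rfl, h⟩
    refine (Cost.forEach (T := 1) (fun rest' m' => ∃ M', m' = { m with M := M' } ∧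
      (∀ k ∈ vs, k ∉ i :: rest → ∀ j ∈ vs, M' k j = true → k = j) ∧
      ∀ j ∈ vs, j ∉ rest' → M' i j = true → i = j) ?_ ?_).imp (by omega) ?_
    · rintro j rest' _ hj ⟨M', rfl, h1, h2⟩
      refine (Cost.store 1 _).imp le_rfl ?_
      rintro _ _ rfl
      refine ⟨_, rfl, fun k hk hk' q hq => ?_, fun q hq hq' => ?_⟩
      · simp only [update_update_apply]
        have := h1 k hk hk' q hq
        grind
      · simp only [update_update_apply]
        have := h2 q hq
        grind
    · exact ⟨M', rfl, h, fun j hj hj' => absurd hj hj'⟩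
    · rintro _ _ ⟨M', rfl, h1, h2⟩
      refine ⟨M', rfl, fun k hk hk' => ?_⟩
      by_cases e : k = i
      · subst e; exact fun j hj => h2 j hj (by simp)
      · exact h1 k hk (by simp [e, hk'])
  · exact ⟨m.M, rfl, fun k hk hk' => absurd hk hk'⟩
  · rintro _ _ ⟨M', rfl, h⟩
    exact ⟨M', rfl, fun i hi => h i hi (by simp)⟩

theorem zeroPairs_cost (vs : List (Fin n)) (hvs : vs.length ≤ n) (m : Mem n) :
    Cost (zeroPairs vs) m (n * (n * 4 + 2) + 1) fun zs m' => m' = m ∧ zs.length ≤ n * n ∧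
      ∀ p, p ∈ zs ↔ p.1 ∈ vs ∧ p.2 ∈ vs ∧ m.M p.1 p.2 = false := by
  let r : Fin n → Fin n → List (Fin n × Fin n) := fun i j => if m.M i j then [] else [(i, j)]
  have hr : ∀ i j, (r i j).length ≤ 1 := fun i j => by simp only [r]; split <;> simp
  have hl : ∀ i, (vs.flatMap (r i)).length ≤ n := fun i =>
    (length_flatMap_le fun j _ => hr i j).trans (by omega)
  refine (Cost.collect (T := n * 3 + 1) (p := n) (fun i => vs.flatMap (r i))
    fun i hi => ⟨hl i, ?_⟩).imp ?_ ?_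
  · refine (Cost.collect (T := 1) (p := 1) (r i) fun j hj => ⟨hr i j, ?_⟩).mono (by omega)
    refine Cost.bind (Cost.load _ _) ?_
    rintro _ m ⟨rfl, rfl⟩
    exact Cost.pure ⟨rfl, rfl⟩
  · calc _ = vs.length * (n * 4 + 2) + 1 := by ring
      _ ≤ _ := by gcongr
  · rintro _ m' ⟨rfl, rfl⟩
    refine ⟨rfl, (length_flatMap_le fun i _ => hl i).trans (Nat.mul_le_mul_right _ hvs), ?_⟩
    rintro ⟨i, j⟩
    simp only [List.mem_flatMap, r]
    grind

end Matrix

/-! ### Slack, and the class of labels that can still move -/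

section Labels

variable {n B : ℕ} (lt : Fin n → Fin n → Bool) {c l a u b : ℚ}

/-- The numbers `c` and `q` differ by an integer. -/
def IntDiff (c q : ℚ) : Prop := ∃ z : ℤ, q = c + z

theorem IntDiff.add (h : IntDiff c a) (z : ℤ) : IntDiff c (a + z) := by
  obtain ⟨w, rfl⟩ := h
  exact ⟨w + z, by push_cast; ring⟩

theorem IntDiff.add_one_le (hl : IntDiff c l) (ha : IntDiff c a) (h : l < a) : l + 1 ≤ a := by
  obtain ⟨w, rfl⟩ := hl
  obtain ⟨z, rfl⟩ := ha
  have h1 : w < z := by simpa using h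
  have h2 : (w : ℚ) + 1 ≤ z := by exact_mod_cast h1
  linarith

open Classical in
/-- `0` if `c` and `q` differ by an integer, and `1` otherwise. -/
noncomputable def off (c q : ℚ) : ℚ := if IntDiff c q then 0 else 1

theorem off_nonneg : 0 ≤ off c a := by unfold off; split <;> simp

theorem off_le_one : off c a ≤ 1 := by unfold off; split <;> simp

theorem off_eq_zero (h : IntDiff c a) : off c a = 0 := if_pos h

/-- If `l` is already in the class of `c`, the increase is a positive integer. Otherwise the
increase may be tiny, but `off` falls from 1 to 0. -/
theorem lo_drop (h : l < a) (ha : IntDiff c a) : -a + off c a ≤ -l + off c l - 1 := by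
  rw [off_eq_zero ha]
  by_cases hl : IntDiff c l
  · rw [off_eq_zero hl]
    linarith [hl.add_one_le ha h]
  · rw [off, if_neg hl]
    linarith

theorem hi_drop (h : b < u) (hb : IntDiff c b) : b + off c b ≤ u + off c u - 1 := by
  rw [off_eq_zero hb]
  by_cases hl : IntDiff c u
  · rw [off_eq_zero hl]
    linarith [hb.add_one_le hl h]
  · rw [off, if_neg hl]
    linarith

/-- An upper bound for the number of changes of the labels of `j` while the labels that change are
set to numbers that differ from `c` by integers. -/
noncomputable def slack (c : ℚ) (lo hi : Fin n → ℚ) (j : Fin n) : ℕ :=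
  ⌊hi j - lo j + off c (lo j) + off c (hi j)⌋.toNat

/-- Only the two `off` terms depend on the reference number, and each lies between 0 and 1. This is
the price of starting a new pass. -/
theorem slack_change (c' : ℚ) (lo hi : Fin n → ℚ) (j : Fin n) :
    slack c' lo hi j ≤ slack c lo hi j + 2 := by
  unfold slack
  have h1 : ⌊hi j - lo j + off c' (lo j) + off c' (hi j)⌋ ≤
      ⌊hi j - lo j + off c (lo j) + off c (hi j) + (2 : ℤ)⌋ := by
    apply Int.floor_le_floor
    push_cast
    linarith [off_nonneg (c := c) (a := lo j), off_nonneg (c := c) (a := hi j),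
      off_le_one (c := c') (a := lo j), off_le_one (c := c') (a := hi j)]
  rw [Int.floor_add_intCast] at h1
  omega

/-- The narrowing steps for `(i, j)` are without effect. -/
def Stable (lo hi : Fin n → ℚ) (i j : Fin n) : Prop :=
  (∀ z, LoEdge lt i j z → lo i + z ≤ lo j) ∧ ∀ z, HiEdge lt i j z → hi j ≤ hi i + z

/-- Labels of active elements: a label that does not differ from `c` by an integer has been
propagated to all other elements. -/
structure Active (B : ℕ) (c : ℚ) (vs : List (Fin n)) (lo hi : Fin n → ℚ) : Prop where
  tame : ∀ j ∈ vs, Tame n B (lo j) ∧ Tame n B (hi j)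
  lo_stable : ∀ i ∈ vs, ¬IntDiff c (lo i) → ∀ j ∈ vs, ∀ z, LoEdge lt i j z → lo i + z ≤ lo j
  hi_stable : ∀ i ∈ vs, ¬IntDiff c (hi i) → ∀ j ∈ vs, ∀ z, HiEdge lt i j z → hi j ≤ hi i + z

variable {lt} {vs : List (Fin n)} {m : Mem n} {i j : Fin n}

theorem Active.mono {B' : ℕ} {lo hi : Fin n → ℚ} (h : Active lt B c vs lo hi) (hB : B ≤ B') :
    Active lt B' c vs lo hi :=
  ⟨fun j hj => ⟨(h.tame j hj).1.mono hB, (h.tame j hj).2.mono hB⟩, h.lo_stable, h.hi_stable⟩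

/-- A label outside the class of `c` cannot cause a change, since its constraints on all active
elements already hold. So every change stems from a label in the class, and integer increments stay
there. The alternative `m.lo i = c` covers the starting element, which is not in `vs`. -/
theorem Active.lo_step (h : Active lt B c vs m.lo m.hi)
    (hi : i ∈ vs ∨ m.lo i = c) (hj : j ∈ vs) (ha : LoStep lt m i j a) :
    a = m.lo j ∨ m.lo j < a ∧ IntDiff c a := by
  rcases ha with ⟨ha, -⟩ | ⟨ha, z, hz, e⟩
  · exact .inl ha
  · refine .inr ⟨ha, ?_⟩
    rw [e]
    refine IntDiff.add ?_ z
    rcases hi with hi | hi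
    · by_contra hc
      exact absurd (h.lo_stable i hi hc j hj z hz) (not_le.2 (e ▸ ha))
    · exact ⟨0, by simp [hi]⟩

theorem Active.hi_step (h : Active lt B c vs m.lo m.hi)
    (hi : i ∈ vs ∨ m.hi i = c) (hj : j ∈ vs) (hb : HiStep lt m i j b) :
    b = m.hi j ∨ b < m.hi j ∧ IntDiff c b := by
  rcases hb with ⟨hb, -⟩ | ⟨hb, z, hz, e⟩
  · exact .inl hb
  · refine .inr ⟨hb, ?_⟩
    rw [e]
    refine IntDiff.add ?_ z
    rcases hi with hi | hi
    · by_contra hc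
      exact absurd (h.hi_stable i hi hc j hj z hz) (not_le.2 (e ▸ hb))
    · exact ⟨0, by simp [hi]⟩

/-- Stability of the labels outside the class survives: such a label has not just been changed, and
changes at the other end of a constraint only raise lower bounds and reduce upper bounds. -/
theorem Active.update {lo hi : Fin n → ℚ} (h : Active lt B c vs lo hi)
    (ha : a = lo j ∨ lo j < a ∧ IntDiff c a) (hb : b = hi j ∨ b < hi j ∧ IntDiff c b)
    (ta : Tame n B a) (tb : Tame n B b) :
    Active lt B c vs (Function.update lo j a) (Function.update hi j b) := by
  have la : lo j ≤ a := by rcases ha with ha | ha <;> [exact ha.ge; exact ha.1.le]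
  have lb : b ≤ hi j := by rcases hb with hb | hb <;> [exact hb.le; exact hb.1.le]
  refine ⟨fun k hk => ?_, fun i hi' hc k hk z hz => ?_, fun i hi' hc k hk z hz => ?_⟩
  · by_cases e : k = j
    · subst e; simp [ta, tb]
    · simpa [e] using h.tame k hk
  · have e1 : Function.update lo j a i = lo i := by
      by_cases e : i = j
      · subst e
        rcases ha with ha | ha
        · simp [ha]
        · simp [ha.2] at hc
      · simp [e]
    have e2 : lo k ≤ Function.update lo j a k := by
      by_cases e : k = j
      · subst e; simpa
      · simp [e]
    rw [e1] at hc ⊢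
    exact (h.lo_stable i hi' hc k hk z hz).trans e2
  · have e1 : Function.update hi j b i = hi i := by
      by_cases e : i = j
      · subst e
        rcases hb with hb | hb
        · simp [hb]
        · simp [hb.2] at hc
      · simp [e]
    have e2 : Function.update hi j b k ≤ hi k := by
      by_cases e : k = j
      · subst e; simpa
      · simp [e]
    rw [e1] at hc ⊢
    exact e2.trans (h.hi_stable i hi' hc k hk z hz)

theorem slack_update_of_ne {lo hi : Fin n → ℚ} {k : Fin n} (h : k ≠ j) :
    slack c (Function.update lo j a) (Function.update hi j b) k = slack c lo hi k := by
  simp [slack, h]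

theorem lo_le (ha : a = l ∨ l < a ∧ IntDiff c a) : -a + off c a ≤ -l + off c l := by
  rcases ha with rfl | ha
  · rfl
  · linarith [lo_drop ha.1 ha.2]

theorem hi_le (hb : b = u ∨ b < u ∧ IntDiff c b) : b + off c b ≤ u + off c u := by
  rcases hb with rfl | hb
  · rfl
  · linarith [hi_drop hb.1 hb.2]

theorem slack_update_le {lo hi : Fin n → ℚ} (ha : a = lo j ∨ lo j < a ∧ IntDiff c a)
    (hb : b = hi j ∨ b < hi j ∧ IntDiff c b) (k : Fin n) :
    slack c (Function.update lo j a) (Function.update hi j b) k ≤ slack c lo hi k := by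
  by_cases h : k = j
  · subst h
    simp only [slack, Function.update_self]
    apply Int.toNat_le_toNat
    apply Int.floor_le_floor
    linarith [lo_le ha, hi_le hb]
  · rw [slack_update_of_ne h]

/-- The quantity under the floor drops by at least 1. The condition `a ≤ b` keeps the new value
nonnegative, so that truncation at 0 does not hide the drop. -/
theorem slack_update_lt {lo hi : Fin n → ℚ} (ha : a = lo j ∨ lo j < a ∧ IntDiff c a)
    (hb : b = hi j ∨ b < hi j ∧ IntDiff c b) (hab : a ≤ b) (hc : lo j < a ∨ b < hi j) :
    slack c (Function.update lo j a) (Function.update hi j b) j < slack c lo hi j := by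
  simp only [slack, Function.update_self]
  have h1 : b - a + off c a + off c b + (1 : ℤ) ≤ hi j - lo j + off c (lo j) + off c (hi j) := by
    push_cast
    rcases hc with hc | hc
    · have hc' : IntDiff c a := by
        rcases ha with ha | ha
        · exact absurd ha hc.ne'
        · exact ha.2
      linarith [lo_drop hc hc', hi_le hb]
    · have hc' : IntDiff c b := by
        rcases hb with hb | hb
        · exact absurd hb hc.ne
        · exact hb.2
      linarith [lo_le ha, hi_drop hc hc']
  have h2 := Int.floor_le_floor h1
  rw [Int.floor_add_intCast] at h2
  have h3 : 0 ≤ ⌊b - a + off c a + off c b⌋ :=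
    Int.floor_nonneg.2 (by
      linarith [off_nonneg (c := c) (a := a), off_nonneg (c := c) (a := b)])
  omega

theorem lo_step_tame (hi : Tame n B (m.lo i)) (hj : Tame n B' (m.lo j)) (hB : B + 1 ≤ B')
    (ha : LoStep lt m i j a) : Tame n B' a := by
  rcases ha with ⟨rfl, -⟩ | ⟨-, z, hz, rfl⟩
  · exact hj
  · exact (hi.add (tame_int (B := 1) z (by exact_mod_cast hz.abs_le))).mono hB

theorem hi_step_tame (hi : Tame n B (m.hi i)) (hj : Tame n B' (m.hi j)) (hB : B + 1 ≤ B')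
    (hb : HiStep lt m i j b) : Tame n B' b := by
  rcases hb with ⟨rfl, -⟩ | ⟨-, z, hz, rfl⟩
  · exact hj
  · exact (hi.add (tame_int (B := 1) z (by exact_mod_cast hz.abs_le))).mono hB

theorem LoStep.le (ha : LoStep lt m i j a) : m.lo j ≤ a := by
  rcases ha with ⟨rfl, -⟩ | ⟨h, -⟩
  · rfl
  · exact h.le

theorem HiStep.le (hb : HiStep lt m i j b) : b ≤ m.hi j := by
  rcases hb with ⟨rfl, -⟩ | ⟨h, -⟩
  · rfl
  · exact h.le

/-- The bound on the labels grows from `B` to `B + 1`, because `ℓ ≤ u` is not tested here and a new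
label can lie at distance 1 from `c`. It grows only once since all these steps start from the fixed
label `c`. -/
theorem startPass_cost {v₀ : Fin n} (hn : 1 ≤ n) (hvs : vs.length ≤ n) (hv₀ : v₀ ∉ vs)
    (hB : B + 2 ≤ 16 * n) (hc : m.lo v₀ = c ∧ m.hi v₀ = c) (tc : Tame n B c)
    (h : Active lt B c vs m.lo m.hi) :
    Cost (startPass lt v₀ vs) m (200 * n ^ 2) fun _ m' =>
      Active lt (B + 1) c vs m'.lo m'.hi ∧ (m'.lo v₀ = c ∧ m'.hi v₀ = c) ∧
      (∀ i ∈ vs, ∀ j ∈ vs, m'.M i j = true → i = j) ∧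
      ∀ j, slack c m'.lo m'.hi j ≤ slack c m.lo m.hi j := by
  unfold startPass
  have hT : n * 3 + 1 + (n * (n * 2 + 2) + 1) + (n * (130 * n + 1) + 1) ≤ 200 * n ^ 2 := by
    nlinarith
  refine Cost.mono (T := n * 3 + 1 + (n * (n * 2 + 2) + 1) + (n * (130 * n + 1) + 1)) ?_ hT
  refine Cost.bind ((Cost.forEach_const (T := 2) (fun m' => ∃ f g, m' = { m with f := f, g := g })
    ?_ ⟨m.f, m.g, rfl⟩).mono (T' := n * 3 + 1) (by gcongr)) ?_
  · rintro x _ - ⟨f, g, rfl⟩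
    refine Cost.bind (Cost.store 1 _) ?_
    rintro _ _ rfl
    refine (Cost.store 1 _).imp (by omega) ?_
    rintro _ _ rfl
    exact ⟨_, _, rfl⟩
  rintro _ _ ⟨f, g, rfl⟩
  refine Cost.bind (initM_cost vs hvs _) ?_
  rintro _ _ ⟨M', rfl, hM⟩
  refine (Cost.forEach_const (T := 130 * n) (fun m' => Active lt (B + 1) c vs m'.lo m'.hi ∧
    (m'.lo v₀ = c ∧ m'.hi v₀ = c) ∧ m'.M = M' ∧
      ∀ j, slack c m'.lo m'.hi j ≤ slack c m.lo m.hi j) ?_ ?_).imp (T' := _) ?_ ?_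
  · rintro j m' hj ⟨h1, h2, h3, h4⟩
    have t0 : TameAt B m' v₀ := ⟨h2.1 ▸ tc, h2.2 ▸ tc⟩
    have t1 := h1.tame j hj
    refine Cost.bind (narrow_cost lt hn hB ⟨t0.1.mono (by omega), t0.2.mono (by omega)⟩ t1) ?_
    rintro _ _ ⟨a, b, f, g, rfl, ha, hb, -⟩
    have ne : v₀ ≠ j := by rintro rfl; exact hv₀ hj
    have ha' := h1.lo_step (.inr h2.1) hj ha
    have hb' := h1.hi_step (.inr h2.2) hj hb
    refine Cost.pure ⟨?_, by simpa [ne] using h2, h3, fun k => ?_⟩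
    · exact h1.update ha' hb' (lo_step_tame t0.1 t1.1 le_rfl ha) (hi_step_tame t0.2 t1.2 le_rfl hb)
    · exact (slack_update_le ha' hb' k).trans (h4 k)
  · exact ⟨h.mono (by omega), hc, rfl, fun j => le_rfl⟩
  · have : vs.length * (130 * n + 1) ≤ n * (130 * n + 1) := Nat.mul_le_mul_right _ hvs
    omega
  · rintro _ m' ⟨h1, h2, h3, h4⟩
    exact ⟨h1, h2, h3 ▸ hM, h4⟩

end Labels


/-! ### Amortized analysis of the labeling loop -/

section LabelingLoop

variable {n B : ℕ} {lt : Fin n → Fin n → Bool} {vs : List (Fin n)} {c : ℚ} {m : Mem n}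

/-- The pairs of entries of `vs` at which `M` is 0. -/
def zeros (vs : List (Fin n)) (M : Fin n → Fin n → Bool) : Finset (Fin n × Fin n) :=
  (vs.toFinset ×ˢ vs.toFinset).filter fun p => M p.1 p.2 = false

/-- An upper bound for the number of rounds of the labeling loop. -/
noncomputable def rounds (c : ℚ) (vs : List (Fin n)) (m : Mem n) : ℕ :=
  (zeros vs m.M).card + (2 * n + 1) * ∑ j ∈ vs.toFinset, slack c m.lo m.hi j

theorem toFinset_card_le (hvs : vs.length ≤ n) : vs.toFinset.card ≤ n :=
  (List.toFinset_card_le vs).trans hvs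

/-- The new zeros lie in one row and one column; this 2n is why a unit of slack has weight 2n + 1 in
`rounds`. -/
theorem zeros_reset {M M' : Fin n → Fin n → Bool} {j : Fin n} (hvs : vs.length ≤ n)
    (h : ∀ p q, M' p q = M p q ∨ M' p q = false ∧ ((p = j ∧ q ∈ vs) ∨ (q = j ∧ p ∈ vs))) :
    (zeros vs M').card ≤ (zeros vs M).card + 2 * n := by
  have hsub : zeros vs M' ⊆
      zeros vs M ∪ (vs.toFinset.image (fun q => (j, q)) ∪ vs.toFinset.image fun p => (p, j)) := by
    rintro ⟨p, q⟩ hp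
    simp only [zeros, Finset.mem_filter, Finset.mem_product, List.mem_toFinset, Finset.mem_union,
      Finset.mem_image, Prod.mk.injEq] at hp ⊢
    rcases h p q with e | ⟨-, ⟨rfl, hq⟩ | ⟨rfl, hq⟩⟩
    · exact .inl ⟨hp.1, e ▸ hp.2⟩
    · exact .inr (.inl ⟨q, hq, rfl, rfl⟩)
    · exact .inr (.inr ⟨p, hq, rfl, rfl⟩)
  have h1 := Finset.card_le_card hsub
  have h2 := Finset.card_union_le (zeros vs M)
    (vs.toFinset.image (fun q => (j, q)) ∪ vs.toFinset.image fun p => (p, j))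
  have h3 := Finset.card_union_le (vs.toFinset.image (fun q => (j, q)))
    (vs.toFinset.image fun p => (p, j))
  have h4 := Finset.card_image_le (s := vs.toFinset) (f := fun q => (j, q))
  have h5 := Finset.card_image_le (s := vs.toFinset) (f := fun p => (p, j))
  have h6 := toFinset_card_le hvs
  omega

theorem zeros_set {M : Fin n → Fin n → Bool} {i j : Fin n} (hi : i ∈ vs) (hj : j ∈ vs)
    (hM : M i j = false) :
    (zeros vs (Function.update M i (Function.update (M i) j true))).card < (zeros vs M).card := by
  apply Finset.card_lt_card
  rw [Finset.ssubset_iff_of_subset]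
  · exact ⟨(i, j), by simp [zeros, hi, hj, hM], by simp [zeros]⟩
  · rintro ⟨p, q⟩
    simp only [zeros, Finset.mem_filter, update_update_apply]
    grind

theorem Stable.update {lo hi : Fin n → ℚ} {a b : ℚ} {i j k : Fin n} (h : Stable lt lo hi i k)
    (hi' : i ≠ j) (hk : k ≠ j) :
    Stable lt (Function.update lo j a) (Function.update hi j b) i k := by
  simpa [Stable, hi', hk] using h

/-- By irreflexivity the pair `(i, i)` counts as incomparable and yields only trivial constraints.
So the diagonal 1s of `M` fit the invariant that a 1 means stability. -/
theorem stable_self (hirr : ∀ i, lt i i = false) (lo hi : Fin n → ℚ) (i : Fin n) :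
    Stable lt lo hi i i := by
  refine ⟨?_, ?_⟩
  · rintro z (⟨h, -⟩ | ⟨-, -, rfl⟩)
    · simp [hirr] at h
    · simp
  · rintro z (⟨-, h, -⟩ | ⟨-, -, rfl⟩)
    · simp [hirr] at h
    · simp

/-- The potential is 400n² per possible round, plus one final round. When the loop ends with all
entries 1, the weight of the remaining slack is returned as credit, so slack is paid for once over
all passes. -/
theorem labelingLoop_exec {v₀ : Fin n} (hirr : ∀ i, lt i i = false) (hn : 1 ≤ n)
    (hvs : vs.length ≤ n) (hv₀ : v₀ ∉ vs) (hB : B + 1 ≤ 16 * n) (hc : m.lo v₀ = c ∧ m.hi v₀ = c)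
    (h : Active lt B c vs m.lo m.hi) (hM : ∀ i ∈ vs, ∀ j ∈ vs, m.M i j = true → i = j) :
    Exec (labelingLoop lt vs) m fun r m' k =>
      (r = none → (m'.lo v₀ = c ∧ m'.hi v₀ = c) ∧ Active lt B c vs m'.lo m'.hi ∧
        ∀ i ∈ vs, ∀ j ∈ vs, Stable lt m'.lo m'.hi i j) ∧
      k + (if r = none then
        400 * n ^ 2 * ((2 * n + 1) * ∑ j ∈ vs.toFinset, slack c m'.lo m'.hi j) else 0) ≤
        400 * n ^ 2 * (rounds c vs m + 1) := by
  unfold labelingLoop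
  refine loop_exec (fun _ m' => (m'.lo v₀ = c ∧ m'.hi v₀ = c) ∧ Active lt B c vs m'.lo m'.hi ∧
      ∀ i ∈ vs, ∀ j ∈ vs, m'.M i j = true → Stable lt m'.lo m'.hi i j)
    (fun _ m' => 400 * n ^ 2 * (rounds c vs m' + 1))
    (fun r m' => if r = none then
        400 * n ^ 2 * ((2 * n + 1) * ∑ j ∈ vs.toFinset, slack c m'.lo m'.hi j) else 0)
    (Q := fun r m' => r = none → (m'.lo v₀ = c ∧ m'.hi v₀ = c) ∧ Active lt B c vs m'.lo m'.hi ∧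
        ∀ i ∈ vs, ∀ j ∈ vs, Stable lt m'.lo m'.hi i j) ?_
    ⟨hc, h, fun i hi j hj e => hM i hi j hj e ▸ stable_self hirr _ _ i⟩
  clear hc h hM
  rintro - m ⟨hc, h, hM⟩
  have main : Cost (do
      let zs ← zeroPairs vs
      let p ← pick zs
      match p with
      | none => pure (Sum.inr none)
      | some (i, j) => do
        let changed ← narrow lt i j
        let l ← readLo j
        let u ← readHi j
        let bad ← isLt u l
        if bad then pure (Sum.inr (some j))
        else if changed then do
          resetM vs j
          pure (Sum.inl ())
        else do
          writeM i j true
          pure (Sum.inl ()) : Comp n (Unit ⊕ Option (Fin n))) m (399 * n ^ 2) fun r m' =>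
        match r with
        | .inl _ => rounds c vs m' < rounds c vs m ∧ (m'.lo v₀ = c ∧ m'.hi v₀ = c) ∧
            Active lt B c vs m'.lo m'.hi ∧
            ∀ i ∈ vs, ∀ j ∈ vs, m'.M i j = true → Stable lt m'.lo m'.hi i j
        | .inr none => (m'.lo = m.lo ∧ m'.hi = m.hi) ∧
            ∀ i ∈ vs, ∀ j ∈ vs, Stable lt m'.lo m'.hi i j
        | .inr (some _) => True := by
    -- Scan, choice, narrowing steps, comparison of the two labels, and update of `M`. The tick of
    -- the loop then makes 399n² into at most 400n².
    have hT : (n * (n * 4 + 2) + 1) + (n * n + 1) + 130 * n + 36 * n + (n * 3 + 1) ≤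
        399 * n ^ 2 := by nlinarith
    refine Cost.mono ?_ hT
    refine Cost.bind (zeroPairs_cost vs hvs m) ?_
    rintro zs m ⟨rfl, hl, hz⟩
    refine Cost.bind ((Cost.pick zs).mono (T' := n * n + 1) (by omega)) ?_
    rintro p _ ⟨hp1, hp2, rfl⟩
    cases p with
    | none =>
      refine Cost.pure ⟨⟨rfl, rfl⟩, fun i hi j hj => hM i hi j hj ?_⟩
      by_contra hf
      have := (hz (i, j)).2 ⟨hi, hj, Bool.eq_false_iff.2 hf⟩
      simp [hp1 rfl] at this
    | some p =>
      obtain ⟨i, j⟩ := p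
      obtain ⟨hi, hj, hij⟩ := (hz (i, j)).1 (hp2 _ rfl)
      dsimp only at hi hj hij ⊢
      refine Cost.bind (narrow_cost lt hn hB (h.tame i hi) (h.tame j hj)) ?_
      rintro ch _ ⟨a, b, f, g, rfl, ha, hb, hch, hnch⟩
      have ta := lo_step_tame (h.tame i hi).1 ((h.tame j hj).1.mono (Nat.le_succ B)) le_rfl ha
      have tb := hi_step_tame (h.tame i hi).2 ((h.tame j hj).2.mono (Nat.le_succ B)) le_rfl hb
      have ba := ta.bits_le hB hn
      have bb := tb.bits_le hB hn
      refine Cost.bind ((Cost.load _ _).mono (T' := 9 * n) (by simpa using ba)) ?_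
      rintro l _ ⟨rfl, rfl⟩
      refine Cost.bind ((Cost.load _ _).mono (T' := 9 * n) (by simpa using bb)) ?_
      rintro u _ ⟨rfl, rfl⟩
      simp only [Function.update_self]
      refine Cost.bind ((Cost.isLt _ _).mono (T' := 18 * n) (by omega)) ?_
      rintro bad _ ⟨rfl, rfl⟩
      refine Cost.ite (fun _ => Cost.pure trivial) fun hbad => Cost.ite (fun hc1 => ?_) fun hc1 => ?_
      · have hab : a ≤ b := by simpa using hbad
        refine Cost.bind ((resetM_cost vs j _).mono (T' := n * 3 + 1) (by omega)) ?_
        rintro _ _ ⟨M', rfl, hM1, hM2⟩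
        have ha' := h.lo_step (.inl hi) hj ha
        have hb' := h.hi_step (.inl hi) hj hb
        have ne : v₀ ≠ j := by rintro rfl; exact hv₀ hj
        refine Cost.pure ⟨?_, by simpa [ne] using hc, ?_, fun p hp q hq hpq => ?_⟩
        · have s1 := zeros_reset (vs := vs) hvs hM1
          have s2 : ∑ k ∈ vs.toFinset,
              slack c (Function.update m.lo j a) (Function.update m.hi j b) k <
              ∑ k ∈ vs.toFinset, slack c m.lo m.hi k :=
            Finset.sum_lt_sum (fun k _ => slack_update_le ha' hb' k)
              ⟨j, by simpa using hj, slack_update_lt ha' hb' hab (hch hc1)⟩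
          have s3 := Nat.mul_le_mul_left (2 * n + 1) (Nat.succ_le_of_lt s2)
          rw [Nat.mul_succ] at s3
          simp only [rounds]
          simp only at s1
          omega
        -- Since the test `ℓ(j) ≤ u(j)` was passed, both new labels lie between the old ones; so `B`
        -- does not grow during the loop.
        · refine h.update ha' hb' (.of_le_of_le ta.1 ?_ ?_) (.of_le_of_le tb.1 ?_ ?_)
          · exact (abs_le.1 (h.tame j hj).1.2).1.trans ha.le
          · exact hab.trans (hb.le.trans (abs_le.1 (h.tame j hj).2.2).2)
          · exact ((abs_le.1 (h.tame j hj).1.2).1.trans ha.le).trans hab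
          · exact hb.le.trans (abs_le.1 (h.tame j hj).2.2).2
        -- An off-diagonal 1 that survives the reset avoids row and column `j`, and its pair does
        -- not involve the changed labels.
        · by_cases e : p = q
          · exact e ▸ stable_self hirr _ _ p
          have hpj : p ≠ j := by
            rintro rfl
            simp [(hM2 q hq (Ne.symm e)).1] at hpq
          have hqj : q ≠ j := by
            rintro rfl
            simp [(hM2 p hp e).2] at hpq
          refine (hM p hp q hq ?_).update hpj hqj
          rcases hM1 p q with e' | ⟨e', -⟩
          · exact e'.symm.trans hpq
          · simp [e'] at hpq
      · obtain ⟨rfl, rfl⟩ := hnch (Bool.eq_false_iff.2 hc1)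
        refine Cost.bind (Cost.store 1 _) ?_
        rintro _ _ rfl
        simp only [Function.update_eq_self]
        refine Cost.pure ⟨?_, hc, h, fun p hp q hq hpq => ?_⟩
        · simp only [rounds]
          have := zeros_set hi hj hij
          omega
        · simp only [update_update_apply] at hpq
          split_ifs at hpq with hpq'
          · obtain ⟨rfl, rfl⟩ := hpq'
            refine ⟨?_, ?_⟩
            · rcases ha with ⟨-, ha⟩ | ⟨ha, -⟩
              · exact ha
              · exact absurd ha (lt_irrefl _)
            · rcases hb with ⟨-, hb⟩ | ⟨hb, -⟩
              · exact hb
              · exact absurd hb (lt_irrefl _)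
          · exact hM p hp q hq hpq
  have hn2 : 1 ≤ n ^ 2 := Nat.one_le_pow _ _ hn
  refine Exec.imp main ?_
  rintro (⟨⟩ | _ | j) m' k ⟨hk, hq⟩
  · obtain ⟨h1, h2⟩ := hq
    refine ⟨h2, ?_⟩
    have := Nat.mul_le_mul_left (400 * n ^ 2) (Nat.succ_le_of_lt h1)
    rw [Nat.succ_eq_add_one] at this
    rw [Nat.mul_succ (400 * n ^ 2) (rounds c vs m)]
    omega
  · obtain ⟨⟨h1, h2⟩, h3⟩ := hq
    refine ⟨fun _ => ⟨?_, ?_, h3⟩, ?_⟩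
    · rwa [h1, h2]
    · rwa [h1, h2]
    · simp only [if_true, rounds, h1, h2, mul_add]
      omega
  · refine ⟨by simp, ?_⟩
    simp only [reduceCtorEq, if_false, mul_add]
    omega

end LabelingLoop


/-! ### Cost of assigning types -/

section AssignTypes

variable {n B K b : ℕ} {lo hi : Fin n → ℚ} {m : Mem n}

theorem length_letters_le (S : Finset IType) : (letters S).length ≤ 4 :=
  List.length_filter_le _ _

theorem card_types_le (S : Finset IType) : S.card ≤ 4 := by
  have h : S ⊆ {IType.A, IType.B, IType.C, IType.D} := fun x _ => by cases x <;> simp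
  exact (Finset.card_le_card h).trans (by decide)

theorem length_arrangements_le {ls : List IType} (h : ls.length ≤ 4) :
    ∀ t, (arrangements ls t).length ≤ 4 ^ t
  | 0 => by simp [arrangements]
  | t + 1 => by
    rw [arrangements, pow_succ]
    refine (length_flatMap_le (p := 4) fun w _ => ?_).trans
      (Nat.mul_le_mul_right _ (length_arrangements_le h t))
    rw [List.length_map]
    exact (List.length_filter_le _ _).trans h

theorem length_nodes_le (S : Finset IType) {t : ℕ} (ht : t ≤ 4) :
    (arrangements (letters S) t).length ≤ 256 :=
  (length_arrangements_le (length_letters_le S) t).trans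
    (Nat.pow_le_pow_right (n := 4) (by norm_num) ht)

/-- The labels are `lo` and `hi`; at the positions up to `K`, the numbers of elements and of nodes
are bounded, and at most `b` pointers go back from each node. -/
def Level (K b : ℕ) (lo hi : Fin n → ℚ) (m : Mem n) : Prop :=
  (m.lo = lo ∧ m.hi = hi) ∧ ∀ k ≤ K, (m.bucket k).length ≤ 4 ∧ (m.nodes k).length ≤ 256 ∧
    ∀ T, (m.back k T).length ≤ b

theorem Level.mono {b' : ℕ} (h : Level K b lo hi m) (hb : b ≤ b') : Level K b' lo hi m :=
  ⟨h.1, fun k hk => ⟨(h.2 k hk).1, (h.2 k hk).2.1, fun T => ((h.2 k hk).2.2 T).trans hb⟩⟩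

theorem compatible_cost (lt : Fin n → Fin n → Bool) {k : ℕ} (hk : (m.bucket k).length ≤ 4)
    (hk' : (m.bucket (k + 1)).length ≤ 4) (T₁ T₂ : TypeList) :
    Cost (compatible lt k T₁ T₂) m 200 fun _ m' => m' = m := by
  unfold compatible
  refine Cost.bind (Cost.load _ _) ?_
  rintro _ _ ⟨rfl, rfl⟩
  refine Cost.bind (Cost.load _ _) ?_
  rintro _ m ⟨rfl, rfl⟩
  refine Cost.bind (Cost.tick _) ?_
  rintro _ m rfl
  have hl : ((((m.bucket k).zip T₁).map fun p => (p.1, (⟨0, p.2⟩ : Interval))) ++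
      ((m.bucket (k + 1)).zip T₂).map fun p => (p.1, (⟨1, p.2⟩ : Interval))).length ≤ 8 := by
    simp only [List.length_append, List.length_map, List.length_zip]
    omega
  generalize ((((m.bucket k).zip T₁).map fun p => (p.1, (⟨0, p.2⟩ : Interval))) ++
      ((m.bucket (k + 1)).zip T₂).map fun p => (p.1, (⟨1, p.2⟩ : Interval))) = l at hl ⊢
  refine (Cost.allOf (T := 17) (fun _ m' => m' = m) (fun _ => True) ?_ rfl).imp (by omega)
    (by rintro _ _ ⟨⟨_, h⟩, -⟩; exact h)
  rintro p _ m - rfl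
  refine (Cost.allOf (T := 1) (fun _ m' => m' = m) (fun _ => True) ?_ rfl).imp (by omega)
    (by rintro _ _ ⟨⟨_, h⟩, -⟩; exact ⟨h, fun _ => trivial⟩)
  rintro q _ m - rfl
  refine Cost.bind (Cost.tick 1) ?_
  rintro _ m rfl
  exact Cost.pure ⟨rfl, fun _ => trivial⟩

theorem addPointers_cost (h : Level K b lo hi m) (k : ℕ) (T₁ T₂ : TypeList) :
    Cost (addPointers k T₁ T₂) m 2 fun _ m' => Level K (b + 1) lo hi m' := by
  refine (Cost.store 2 _).imp le_rfl ?_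
  rintro _ _ rfl
  refine ⟨h.1, fun j hj => ⟨(h.2 j hj).1, (h.2 j hj).2.1, fun T => ?_⟩⟩
  have := (h.2 j hj).2.2 T
  simp only [update_update_apply]
  split_ifs with e
  · obtain ⟨rfl, rfl⟩ := e
    simpa using this
  · omega

/-- There are at most 256² = 65536 pairs of nodes, each adding at most one backward pointer.
Charging all of them to every node is wasteful but needs no record of where pointers were set. -/
theorem linkNodes_cost (lt : Fin n → Fin n → Bool) (h : Level K b lo hi m) {k : ℕ} (hk : k < K) :
    Cost (linkNodes lt k) m (31000000 + 256 * b) fun _ m' => Level K (b + 65536) lo hi m' := by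
  unfold linkNodes
  have h1 := (h.2 k hk.le).2.1
  have h2 := (h.2 (k + 1) hk).2.1
  refine Cost.bind (Cost.load _ _) ?_
  rintro _ _ ⟨rfl, rfl⟩
  refine Cost.bind (Cost.load _ _) ?_
  rintro _ m ⟨rfl, rfl⟩
  generalize m.nodes k = N₁ at h1 ⊢
  generalize m.nodes (k + 1) = N₂ at h2 ⊢
  refine Cost.bind ((Cost.forEach (T := 52000) (fun rest m' => ∃ b',
    b' + 256 * rest.length ≤ b + 65536 ∧ Level K b' lo hi m') ?_
    ⟨b, by omega, h⟩).mono (T' := 256 * 52001 + 1) (by gcongr)) ?_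
  · rintro T₁ rest m - ⟨b', hb', h⟩
    refine (Cost.forEach (T := 202) (fun rest' m' => ∃ b'',
      b'' + rest'.length ≤ b' + 256 ∧ Level K b'' lo hi m') ?_ ⟨b', by omega, h⟩).imp
      (T' := 52000) (by omega) ?_
    · rintro T₂ rest' m - ⟨b'', hb'', h⟩
      refine Cost.bind (compatible_cost lt (h.2 k hk.le).1 (h.2 (k + 1) hk).1 T₁ T₂) ?_
      rintro ok m rfl
      rw [List.length_cons] at hb''
      refine Cost.ite (fun _ => ?_) fun _ => Cost.pure ⟨b'', by omega, h⟩
      refine (addPointers_cost h k T₁ T₂).imp (by omega) ?_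
      exact fun _ _ h => ⟨b'' + 1, by omega, h⟩
    · rintro _ m' ⟨b'', hb'', h⟩
      rw [List.length_cons] at hb'
      rw [List.length_nil] at hb''
      exact ⟨b'', by omega, h⟩
  rintro _ m ⟨b', hb', h⟩
  rw [List.length_nil] at hb'
  have hr : ∀ T, (if (m.back (k + 1) T).isEmpty then [] else [T]).length ≤ 1 := fun T => by
    split <;> simp
  refine Cost.bind ((Cost.collect (T := b + 65537) (p := 1)
    (fun T => if (m.back (k + 1) T).isEmpty then [] else [T])
    fun T _ => ⟨hr T, ?_⟩).mono (T' := 256 * (b + 65539) + 1) (by gcongr)) ?_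
  · have := (h.2 (k + 1) hk).2.2 T
    refine Cost.bind ((Cost.load _ _).mono (T' := b + 65537) (by omega)) ?_
    rintro _ m ⟨rfl, rfl⟩
    exact Cost.pure ⟨rfl, rfl⟩
  rintro N m ⟨hN, rfl⟩
  have hN' : N.length ≤ 256 := by
    rw [hN]
    exact (length_flatMap_le fun T _ => hr T).trans (by omega)
  refine Cost.bind (Cost.store _ _) ?_
  rintro _ _ rfl
  refine Cost.pure ((show Level K b' lo hi _ from ?_).mono (by omega))
  refine ⟨h.1, fun j hj => ⟨(h.2 j hj).1, ?_, (h.2 j hj).2.2⟩⟩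
  by_cases e : j = k + 1
  · subst e; simpa using hN'
  · simpa [e] using (h.2 j hj).2.1

theorem setTypes_cost (h : Level K b lo hi m) {k : ℕ} (hk : k ≤ K) (T : TypeList) :
    Cost (setTypes k T) m 14 fun _ m' => Level K b lo hi m' := by
  have h1 := (h.2 k hk).1
  refine Cost.bind (Cost.load _ _) ?_
  rintro _ m ⟨rfl, rfl⟩
  have hl : ((m.bucket k).zip T).length ≤ 4 := by
    rw [List.length_zip]; omega
  refine (Cost.forEach_const (T := 1) (Level K b lo hi) ?_ h).mono (by omega)
  rintro p m - h
  refine (Cost.store 1 _).imp le_rfl ?_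
  rintro _ _ rfl
  exact h

theorem traceBack_cost : ∀ {k : ℕ} {m : Mem n}, Level K b lo hi m → k ≤ K → ∀ T : TypeList,
    Cost (traceBack k T) m ((k + 1) * (2 * b + 16)) fun _ m' => Level K b lo hi m'
  | 0, _, h, hk, T => (setTypes_cost h hk T).mono (by omega)
  | k + 1, m, h, hk, T => by
    rw [traceBack, Nat.succ_mul (k + 1)]
    refine Cost.bind (setTypes_cost h hk T) fun _ m h => ?_
    have hb := (h.2 (k + 1) hk).2.2 T
    refine Cost.bind ((Cost.load _ _).mono (T' := b + 1) (by omega)) ?_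
    rintro _ m ⟨rfl, rfl⟩
    refine Cost.bind ((Cost.pick _).mono (T' := b + 1) (by omega)) ?_
    rintro T' _ ⟨-, -, rfl⟩
    cases T' with
    | none => exact Cost.pure h
    | some T' =>
      refine Cost.mono (traceBack_cost (k := k) (m := { m with clock := m.clock + 1 }) h
        (by omega) T') ?_
      omega

/-- The parameter `p` is the order in which the two numbers are compared, so that minimum and
maximum are treated together. -/
theorem fold_ctr_cost {v : ℚ} {X : List (Fin n)} {p : ℚ → ℚ → ℚ × ℚ} (hn : 1 ≤ n)
    (hB : B ≤ 16 * n) (hX : X.length ≤ n) (hp : ∀ a q, p a q = (a, q) ∨ p a q = (q, a))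
    (hm : ∀ x ∈ X, Tame n B (m.ctr x)) (hv : Tame n B v) :
    Cost (fold (fun a x => do
      let q ← readCtr x
      let b ← isLt (p a q).1 (p a q).2
      pure (if b then q else a)) v X) m (n * (27 * n + 1) + 1) fun q m' =>
        Tame n B q ∧ m' = m := by
  refine (Cost.fold (T := 27 * n) (Tame n B) ?_ hv).mono (by gcongr)
  intro a x hx ha
  have b1 := ha.bits_le hB hn
  have b2 := (hm x hx).bits_le hB hn
  refine Cost.bind (Cost.load _ _) ?_
  rintro _ m ⟨rfl, rfl⟩
  have hb : bits (p a (m.ctr x)).1 + bits (p a (m.ctr x)).2 ≤ 18 * n := by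
    rcases hp a (m.ctr x) with e | e <;> rw [e] <;> dsimp only <;> omega
  refine Cost.bind (Cost.isLt _ _) ?_
  rintro _ _ ⟨rfl, rfl⟩
  refine Cost.pure ⟨?_, rfl⟩
  split
  · exact hm x hx
  · exact ha

theorem createAll_cost (S : Finset IType) (hb : ∀ k ≤ K, (m.bucket k).length ≤ 4) :
    Cost (forEach (List.range (K + 1)) fun k => do
      let b ← readBucket k
      createNodes S k b.length) m ((K + 1) * 1291 + 1) fun _ m' => Level K 0 m.lo m.hi m' := by
  refine (Cost.forEach (T := 1290) (fun rest m' => (m'.lo = m.lo ∧ m'.hi = m.hi) ∧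
    m'.bucket = m.bucket ∧ ∀ k ≤ K, k ∉ rest → (m'.nodes k).length ≤ 256 ∧
      ∀ T, (m'.back k T).length ≤ 0) ?_ ?_).imp (by simp) ?_
  · rintro k rest m' hk ⟨h1, h2, h3⟩
    have hk' : k ≤ K := by simpa [Nat.lt_succ_iff] using hk
    have hl : (m'.bucket k).length ≤ 4 := by rw [h2]; exact hb k hk'
    have hN := length_nodes_le S hl
    refine Cost.bind (Cost.load _ _) ?_
    rintro _ m' ⟨rfl, rfl⟩
    refine (Cost.store _ _).imp ?_ ?_
    -- At most (256 + 1)(4 + 1) = 1285 units, plus 5 for reading the bucket.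
    · have := Nat.mul_le_mul (Nat.add_le_add_right hN 1) (Nat.add_le_add_right hl 1)
      omega
    · rintro _ _ rfl
      refine ⟨h1, h2, fun j hj hj' => ?_⟩
      by_cases e : j = k
      · subst e; simpa using hN
      · simpa [e] using h3 j hj (by simp [e, hj'])
  · exact ⟨⟨rfl, rfl⟩, rfl, fun k hk hk' => by simp at hk'; omega⟩
  · rintro _ m' ⟨h1, h2, h3⟩
    exact ⟨h1, fun k hk => ⟨by rw [h2]; exact hb k hk, h3 k hk (by simp)⟩⟩

/-- The pointer bound is allowed to grow by 65536 at each position. This makes the bound quadratic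
in `K`, which is affordable within a pass. -/
theorem linkAll_cost (lt : Fin n → Fin n → Bool) (h : Level K 0 lo hi m) :
    Cost (allOf (List.range K) fun k => linkNodes lt k) m
      (K * (31000001 + 256 * (65536 * K)) + 1) fun _ m' => Level K (65536 * K) lo hi m' := by
  refine (Cost.allOf (T := 31000000 + 256 * (65536 * K)) (fun rest m' => ∃ b,
    b + 65536 * rest.length ≤ 65536 * K ∧ Level K b lo hi m') (fun _ => True) ?_
    ⟨0, by simp, h⟩).imp (le_of_eq (by rw [List.length_range]; ring)) ?_
  · rintro k rest m hk ⟨b, hb, h⟩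
    rw [List.length_cons] at hb
    refine (linkNodes_cost lt h (List.mem_range.1 hk)).imp (by omega) ?_
    exact fun _ _ h => ⟨⟨b + 65536, by omega, h⟩, fun _ => trivial⟩
  · rintro _ m ⟨⟨rest, b, hb, h⟩, -⟩
    exact h.mono (by omega)

/-- Whatever index is computed, each element lengthens one bucket by one; bucket length plus
elements left stays at most n. -/
theorem fillBuckets_cost {X : List (Fin n)} {low : ℚ} (hn : 1 ≤ n) (hB : 2 * B ≤ 16 * n)
    (hX : X.length ≤ n) (hlow : Tame n B low) (hm : ∀ x ∈ X, Tame n B (m.ctr x))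
    (hb : ∀ k ≤ K, m.bucket k = []) :
    Cost (forEach X fun x => do
      let q ← readCtr x
      let e ← sub q low
      let k ← toIndex e
      pushBucket k x) m (n * (38 * n) + 1) fun _ m' =>
        (m'.lo = m.lo ∧ m'.hi = m.hi) ∧ ∀ k ≤ K, (m'.bucket k).length ≤ n := by
  refine (Cost.forEach (T := 36 * n + 1) (fun rest m' => m'.ctr = m.ctr ∧
    (m'.lo = m.lo ∧ m'.hi = m.hi) ∧ ∀ k ≤ K, (m'.bucket k).length + rest.length ≤ n) ?_ ?_).imp
    (T' := n * (38 * n) + 1) ?_ ?_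
  · rintro x rest m' hx ⟨h0, h1, h2⟩
    have b1 := (hm x hx).bits_le (by omega) hn
    have b2 := hlow.bits_le (by omega) hn
    have b3 := ((hm x hx).sub hlow).bits_le (by omega) hn
    rw [← h0] at b1 b3
    refine Cost.bind (Cost.load _ _) ?_
    rintro _ m' ⟨rfl, rfl⟩
    refine Cost.bind (Cost.sub _ _) ?_
    rintro _ m' ⟨rfl, rfl⟩
    refine Cost.bind (Cost.toIndex _) ?_
    rintro k m' ⟨-, rfl⟩
    refine (Cost.store 1 _).imp (by omega) ?_
    rintro _ _ rfl
    refine ⟨h0, h1, fun j hj => ?_⟩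
    have := h2 j hj
    rw [List.length_cons] at this
    by_cases e : j = k
    · subst e; simp; omega
    · simp [e]; omega
  · exact ⟨rfl, ⟨rfl, rfl⟩, fun k hk => by simpa [hb k hk] using hX⟩
  · exact Nat.add_le_add_right (Nat.mul_le_mul hX (by omega)) 1
  · rintro _ m' ⟨-, h1, h2⟩
    exact ⟨h1, fun k hk => by simpa using h2 k hk⟩

theorem assignTypes_cost (lt : Fin n → Fin n → Bool) (S : Finset IType) {v₀ : Fin n}
    {X : List (Fin n)} (hn : 1 ≤ n) (hB : 2 * B ≤ 16 * n) (hX : X.length ≤ n) (hv₀ : v₀ ∈ X)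
    (hm : ∀ x ∈ X, Tame n B (m.lo x)) :
    Cost (assignTypes lt S v₀ X) m (10 ^ 12 * n ^ 2) fun _ m' => m'.lo = m.lo ∧ m'.hi = m.hi := by
  have hT : (n * (18 * n + 1) + 1) + 9 * n + (n * (27 * n + 1) + 1) + (n * (27 * n + 1) + 1) +
      18 * n + 9 * n + ((16 * n + 1) * 2 + 1) + (n * (38 * n) + 1) + ((16 * n + 1) * (n + 2) + 1) +
      ((16 * n + 1) * 1291 + 1) + (16 * n * (31000001 + 256 * (65536 * (16 * n))) + 1) + 257 + 257 +
      (16 * n + 1) * (2 * (65536 * (16 * n)) + 16) ≤ 10 ^ 12 * n ^ 2 := by nlinarith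
  refine Cost.mono ?_ hT
  unfold assignTypes
  refine Cost.bind ((Cost.forEach (T := 18 * n) (fun rest m' => ∃ ctr, m' = { m with ctr := ctr } ∧
    ∀ x ∈ X, x ∉ rest → Tame n B (ctr x)) ?_
    ⟨m.ctr, rfl, fun x hx hx' => absurd hx hx'⟩).mono (T' := n * (18 * n + 1) + 1) (by gcongr)) ?_
  · rintro x rest _ hx ⟨ctr, rfl, h⟩
    have b1 := (hm x hx).bits_le (by omega) hn
    refine Cost.bind ((Cost.load _ _).mono (T' := 9 * n) b1) ?_
    rintro _ _ ⟨rfl, rfl⟩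
    refine (Cost.store _ _).imp (by dsimp only; omega) ?_
    rintro _ _ rfl
    refine ⟨_, rfl, fun y hy hy' => ?_⟩
    by_cases e : y = x
    · subst e; simpa using hm y hy
    · simpa [e] using h y hy (by simp [e, hy'])
  rintro _ _ ⟨ctr, rfl, hc⟩
  replace hc : ∀ x ∈ X, Tame n B (ctr x) := fun x hx => hc x hx (by simp)
  refine Cost.bind ((Cost.load _ _).mono (T' := 9 * n)
    ((hc v₀ hv₀).bits_le (by omega) hn)) ?_
  rintro _ _ ⟨rfl, rfl⟩
  refine Cost.bind (fold_ctr_cost (p := fun a q => (q, a)) hn (by omega) hX (fun _ _ => .inr rfl)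
    hc (hc v₀ hv₀)) ?_
  rintro low _ ⟨hlow, rfl⟩
  refine Cost.bind (fold_ctr_cost (p := fun a q => (a, q)) hn (by omega) hX (fun _ _ => .inl rfl)
    hc (hc v₀ hv₀)) ?_
  rintro high _ ⟨hhigh, rfl⟩
  have b1 := hlow.bits_le (by omega) hn
  have b2 := hhigh.bits_le (by omega) hn
  have td := hhigh.sub hlow
  refine Cost.bind ((Cost.sub _ _).mono (T' := 18 * n) (by omega)) ?_
  rintro _ _ ⟨rfl, rfl⟩
  refine Cost.bind ((Cost.toIndex _).mono (T' := 9 * n) (td.bits_le (by omega) hn)) ?_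
  rintro K _ ⟨hK, rfl⟩
  -- All centers are at most `B` in absolute value, so they span at most `2 * B`.
  replace hK : K ≤ 16 * n := by
    have h1 : ⌊high - low⌋ ≤ ((B + B : ℕ) : ℤ) := by
      rw [← Int.floor_natCast (R := ℚ) (B + B)]
      exact Int.floor_le_floor (abs_le.1 td.2).2
    omega
  refine Cost.bind ((Cost.forEach (T := 1) (fun rest m' => ∃ bucket,
    m' = { m with ctr := ctr, bucket := bucket } ∧ ∀ k ≤ K, k ∉ rest → bucket k = []) ?_
    ⟨m.bucket, rfl, fun k hk hk' => by simp at hk'; omega⟩).mono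
    (T' := (16 * n + 1) * 2 + 1) (by rw [List.length_range]; gcongr)) ?_
  · rintro k rest _ hk ⟨bucket, rfl, h⟩
    refine (Cost.store 1 _).imp le_rfl ?_
    rintro _ _ rfl
    refine ⟨_, rfl, fun j hj hj' => ?_⟩
    by_cases e : j = k
    · subst e; simp
    · simpa [e] using h j hj (by simp [e, hj'])
  rintro _ _ ⟨bucket, rfl, hbu⟩
  refine Cost.bind (fillBuckets_cost (K := K) hn hB hX hlow hc fun k hk => hbu k hk (by simp)) ?_
  rintro _ m' ⟨hl, hbu⟩
  -- If this test succeeds, no bucket exceeds `S.card ≤ 4`; from here on, the work at each position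
  -- is bounded independently of n, apart from reading pointer lists.
  refine Cost.bind ((Cost.allOf (T := n + 1) (fun _ m'' => m'' = m')
    (fun k => (m'.bucket k).length ≤ 4) ?_ rfl).mono (T' := (16 * n + 1) * (n + 2) + 1)
    (by rw [List.length_range]; gcongr)) ?_
  · rintro k rest m' hk rfl
    have := hbu k (by simpa [Nat.lt_succ_iff] using hk)
    refine Cost.bind ((Cost.load _ _).mono (T' := n + 1) (by omega)) ?_
    rintro _ m' ⟨rfl, rfl⟩
    exact Cost.pure ⟨rfl, fun h => (of_decide_eq_true h).trans (card_types_le S)⟩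
  rintro small m' ⟨⟨_, rfl⟩, hsmall⟩
  refine Cost.ite (fun hs => ?_) fun _ => Cost.pure hl
  refine Cost.bind ((createAll_cost S fun k hk => hsmall hs k
    (by simpa [Nat.lt_succ_iff] using hk)).mono (T' := (16 * n + 1) * 1291 + 1) (by gcongr)) ?_
  intro _ m' h
  rw [hl.1, hl.2] at h
  refine Cost.bind ((linkAll_cost lt h).mono
    (T' := 16 * n * (31000001 + 256 * (65536 * (16 * n))) + 1) (by gcongr)) ?_
  intro ok m' h
  refine Cost.ite (fun _ => ?_) fun _ => Cost.pure h.1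
  have hN := (h.2 K le_rfl).2.1
  refine Cost.bind ((Cost.load _ _).mono (T' := 257) (by omega)) ?_
  rintro _ m' ⟨rfl, rfl⟩
  refine Cost.bind ((Cost.pick _).mono (T' := 257) (by omega)) ?_
  rintro T _ ⟨-, -, rfl⟩
  cases T with
  | none => exact Cost.pure h.1
  | some T =>
    refine Cost.bind ((traceBack_cost (k := K) (m := { m' with clock := m'.clock + 1 })
      h le_rfl T).mono
      (T' := (16 * n + 1) * (2 * (65536 * (16 * n)) + 16)) (by gcongr)) ?_
    exact fun _ _ h => Cost.pure h.1

end AssignTypes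

/-! ### Cost of certificates -/

section Certificates

variable {n : ℕ} {m : Mem n}

/-- All bodies run on the same memory, so their results can be chosen as a function of the entry, as
`Cost.collect` demands. -/
theorem Cost.collect_length {α β : Type} {l : List α} {body : α → Comp n (List β)} {T p : ℕ}
    (hb : ∀ x ∈ l, Cost (body x) m T fun a m' => a.length ≤ p ∧ m' = m) :
    Cost (SOrder.collect l body) m (l.length * (T + p + 1) + 1) fun _ m' => m' = m := by
  have h : ∀ x ∈ l, ∃ r : List β, r.length ≤ p ∧ Cost (body x) m T fun a m' => a = r ∧ m' = m := by
    intro x hx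
    obtain ⟨a, m', k, hr, hk, ha, rfl⟩ := hb x hx
    exact ⟨a, ha, a, m', k, hr, hk, rfl, rfl⟩
  choose! r hr using h
  exact (Cost.collect r hr).imp le_rfl fun _ _ h => h.2

/-- Each round moves one element to `acc` and uses up one of the `k` rounds, so `acc.length + k` is
constant and bounds every search for a repetition. -/
theorem trail_cost {next : Fin n → Comp n (Option (Fin n))} {v₀ : Fin n}
    (hnext : ∀ v m, Cost (next v) m 1 fun _ m' => m' = m) :
    ∀ (k : ℕ) (v : Fin n) (acc : List (Fin n)) {m : Mem n},
      Cost (trail next v₀ k v acc) m (k * (acc.length + k + 3) + 1) fun l m' =>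
        l.length ≤ acc.length + k + 1 ∧ m' = m
  | 0, v, acc => Cost.bind (Cost.tick 1) (by rintro _ _ rfl; exact Cost.pure ⟨by simp, rfl⟩)
  | k + 1, v, acc => by
    have e : (k + 1) * (acc.length + (k + 1) + 3) + 1 =
        acc.length + 2 + 1 + (k * ((acc.length + 1) + k + 3) + 1 + (k + 1)) := by ring
    rw [e, trail]
    refine Cost.bind (Cost.tick _) ?_
    rintro _ _ rfl
    refine Cost.ite (fun _ => Cost.pure ⟨by simp, rfl⟩) fun _ => ?_
    refine Cost.bind (hnext v _) ?_
    rintro w _ rfl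
    cases w with
    | none => exact Cost.pure ⟨by simp, rfl⟩
    | some w =>
      refine (trail_cost hnext k w (v :: acc)).imp ?_ fun l m' h => ⟨h.1.trans ?_, h.2⟩
      · rw [List.length_cons]; omega
      · rw [List.length_cons]; omega

theorem trails_cost {v₀ : Fin n} (v : Fin n) {α : Type} {T : ℕ}
    {F : List (Fin n) → List (Fin n) → Comp n α} {Q : α → Mem n → Prop}
    (h : ∀ a b : List (Fin n), a.length ≤ n + 1 → b.length ≤ n + 1 → Cost (F a b) m T Q) :
    Cost (do
      let a ← trail readF v₀ n v []
      let b ← trail readG v₀ n v []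
      tick (a.length + b.length)
      F a b) m (2 * (n * (n + 3) + 1) + (2 * n + 2) + T) Q := by
  have e1 : n * (([] : List (Fin n)).length + n + 3) + 1 = n * (n + 3) + 1 := by simp
  refine Cost.bind ((trail_cost (fun v m => (Cost.load _ _).imp le_rfl fun _ _ h => h.2) n v []).mono
    e1.le) ?_
  rintro a m ⟨ha, rfl⟩
  refine Cost.bind ((trail_cost (fun v m => (Cost.load _ _).imp le_rfl fun _ _ h => h.2) n v []).mono
    e1.le) ?_
  rintro b m ⟨hb, rfl⟩
  rw [List.length_nil, zero_add] at ha hb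
  refine Cost.bind ((Cost.tick _).mono (T' := 2 * n + 2) (by omega)) ?_
  rintro _ m rfl
  exact (h a b ha hb).mono (by omega)

theorem scanPositive_cost (lt : Fin n → Fin n → Bool) (x : Fin n) :
    ∀ (ys : List (Fin n)) (prev : Fin n) (val : ℤ) (acc : List (Fin n)) {m : Mem n},
      Cost (scanPositive lt x prev val acc ys) m (3 * ys.length + acc.length + 2) fun _ m' => m' = m
  | [], _, _, _ => Cost.bind (Cost.tick 1) (by rintro _ _ rfl; exact Cost.pure rfl)
  | y :: ys, prev, val, acc => by
    rw [scanPositive, List.length_cons]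
    refine Cost.bind (Cost.tick 2) ?_
    rintro _ _ rfl
    refine Cost.ite (fun _ => ?_) fun _ => ?_
    · refine Cost.bind (Cost.tick _) ?_
      rintro _ _ rfl
      exact Cost.pure rfl
    · refine (scanPositive_cost lt x ys y _ (y :: acc)).mono ?_
      rw [List.length_cons]
      omega

theorem findPositive_cost (lt : Fin n → Fin n → Bool) {L : ℕ} :
    ∀ (l : List (Fin n)) {m : Mem n}, l.length ≤ L →
      Cost (findPositive lt l) m (l.length * (3 * L + 4) + 1) fun _ m' => m' = m
  | [], _, _ => Cost.bind (Cost.tick 1) (by rintro _ _ rfl; exact Cost.pure rfl) (by simp)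
  | x :: xs, _, h => by
    have h' : xs.length + 1 ≤ L := h
    rw [findPositive, List.length_cons, Nat.succ_mul]
    refine Cost.bind (Cost.tick 1) ?_
    rintro _ _ rfl
    refine Cost.bind ((scanPositive_cost lt x xs x 0 [x]).mono (T' := 3 * L + 3)
      (by rw [List.length_singleton]; omega)) ?_
    rintro r _ rfl
    cases r with
    | none => exact (findPositive_cost lt (L := L) xs (by omega)).mono (by omega)
    | some C => exact Cost.pure rfl

theorem positiveCycle_cost (lt : Fin n → Fin n → Bool) (hn : 1 ≤ n) (v₀ v : Fin n) :
    Cost (positiveCycle lt v₀ v) m (200 * n ^ 2) fun _ _ => True := by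
  refine (trails_cost (T := (2 * n + 2) * (3 * (2 * n + 2) + 4) + 1) (Q := fun _ _ => True) v
    fun a b ha hb => ?_).mono (by nlinarith)
  have hl : (a ++ b.reverse.tail).length ≤ 2 * n + 2 := by
    simp only [List.length_append, List.length_tail, List.length_reverse]
    omega
  exact (findPositive_cost lt _ hl).imp (by gcongr) fun _ _ _ => trivial

theorem zeroCycle_cost (hn : 1 ≤ n) (v₀ : Fin n) {X : List (Fin n)} (hX : X.length ≤ n) :
    Cost (zeroCycle v₀ X) m (200 * n ^ 3) fun _ _ => True := by
  have hT : n * (2 * (n * (n + 3) + 1) + (2 * n + 2) + 0 + (2 * n + 2) + 1) + 1 + 1 ≤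
      200 * n ^ 3 := by
    have h1 : n ≤ n ^ 2 := by nlinarith
    have h2 : n ^ 2 ≤ n ^ 3 := Nat.pow_le_pow_right hn (by norm_num)
    ring_nf
    omega
  refine Cost.mono ?_ hT
  refine Cost.bind ((Cost.collect_length (p := 2 * n + 2) fun x hx => trails_cost (T := 0) x
    fun a b ha hb => ?_).mono
    (T' := n * (2 * (n * (n + 3) + 1) + (2 * n + 2) + 0 + (2 * n + 2) + 1) + 1) (by gcongr)) ?_
  · refine Cost.pure ⟨?_, rfl⟩
    simp only [List.length_append, List.length_tail, List.length_reverse]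
    omega
  rintro C m rfl
  refine Cost.bind (Cost.tick 1) ?_
  rintro _ m rfl
  exact Cost.pure trivial

end Certificates


/-! ### Passes and the total time -/

section Algorithm

variable {n : ℕ} {lt : Fin n → Fin n → Bool} {m : Mem n}

theorem flatMap_ite_not {α : Type} (p : α → Prop) [DecidablePred p] (l : List α) :
    (l.flatMap fun x => if p x then [] else [x]) = l.filter fun x => ¬p x := by
  induction l with
  | nil => rfl
  | cons x l ih => by_cases h : p x <;> simp [h, ih]

theorem flatMap_ite {α : Type} (p : α → Prop) [DecidablePred p] (l : List α) :
    (l.flatMap fun x => if p x then [x] else []) = l.filter fun x => p x := by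
  induction l with
  | nil => rfl
  | cons x l ih => by_cases h : p x <;> simp [h, ih]

theorem filter_cost {l : List (Fin n)} (hl : l.length ≤ n) (v : Fin n) :
    Cost (collect l fun x => pure (if x = v then [] else [x])) m (n * 2 + 1) fun a m' =>
      a = l.filter (fun x => ¬x = v) ∧ m' = m := by
  refine (Cost.collect (T := 0) (p := 1) (fun x => if x = v then [] else [x])
    fun x _ => ⟨by split <;> simp, Cost.pure ⟨rfl, rfl⟩⟩).imp (by gcongr) ?_
  rintro _ _ ⟨rfl, rfl⟩
  exact ⟨flatMap_ite_not _ _, rfl⟩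

theorem isEq_labels_cost {B : ℕ} (hn : 1 ≤ n) (hB : B ≤ 16 * n) {x : Fin n} (h : TameAt B m x)
    {F : Bool → List (Fin n)} :
    Cost (do
      let l ← readLo x
      let u ← readHi x
      let b ← isEq l u
      pure (F b)) m (36 * n) fun a m' => a = F (decide (m.lo x = m.hi x)) ∧ m' = m := by
  have b1 := h.1.bits_le hB hn
  have b2 := h.2.bits_le hB hn
  refine Cost.bind (Cost.load _ _) ?_
  rintro _ _ ⟨rfl, rfl⟩
  refine Cost.bind (Cost.load _ _) ?_
  rintro _ _ ⟨rfl, rfl⟩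
  refine Cost.bind (Cost.isEq _ _) ?_
  rintro _ m ⟨rfl, rfl⟩
  exact Cost.pure ⟨rfl, rfl⟩

/-- What holds at the beginning of each pass. -/
def PassInv (lt : Fin n → Fin n → Bool) (s : Fin n × List (Fin n) × ℚ) (m : Mem n) : Prop :=
  ∃ r, r + s.2.1.length + 1 ≤ n ∧ s.1 ∉ s.2.1 ∧ s.2.2 = 1 / 2 ^ r ∧ m.hi s.1 = m.lo s.1 ∧
    Tame n (n + 1 + 2 * r) (m.lo s.1) ∧ Active lt (n + 1 + 2 * r) (m.lo s.1) s.2.1 m.lo m.hi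

/-- The sum of the slacks of the active elements. -/
noncomputable def totalSlack (c : ℚ) (vs : List (Fin n)) (m : Mem n) : ℕ :=
  ∑ j ∈ vs.toFinset, slack c m.lo m.hi j

/-- An upper bound for the time needed from the beginning of a pass to the end. -/
noncomputable def timeLeft (s : Fin n × List (Fin n) × ℚ) (m : Mem n) : ℕ :=
  10 ^ 13 * n ^ 4 * (s.2.1.length + 1) +
    400 * n ^ 2 * (2 * n + 1) * (totalSlack (m.lo s.1) s.2.1 m + 2 * n * s.2.1.length)

theorem tame_pow_half {r : ℕ} (hr : r ≤ n) : Tame n 1 (1 / 2 ^ r) := by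
  refine ⟨⟨2 ^ (n - r), ?_⟩, ?_⟩
  · push_cast
    rw [one_div, inv_mul_eq_iff_eq_mul₀ (by positivity), ← pow_add, Nat.add_sub_cancel' hr]
  · rw [abs_of_pos (by positivity), div_le_iff₀ (by positivity)]
    simpa using one_le_pow₀ (M₀ := ℚ) (n := r) one_le_two

theorem zeros_card_le {vs : List (Fin n)} (hvs : vs.length ≤ n) (M : Fin n → Fin n → Bool) :
    (zeros vs M).card ≤ n * n := by
  refine (Finset.card_filter_le _ _).trans ?_
  rw [Finset.card_product]
  exact Nat.mul_le_mul (toFinset_card_le hvs) (toFinset_card_le hvs)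

/-- What follows the labeling loop in a pass, if `ℓ(v) ≤ u(v)` for all active elements. -/
def finishPass (lt : Fin n → Fin n → Bool) (S : Finset IType) (s : Fin n × List (Fin n) × ℚ) :
    Comp n ((Fin n × List (Fin n) × ℚ) ⊕ Outcome n) := do
  let X ← collect s.2.1 fun x => do
    let l ← readLo x
    let u ← readHi x
    let b ← isEq l u
    pure (if b then [x] else [])
  let rest ← collect s.2.1 fun x => do
    let l ← readLo x
    let u ← readHi x
    let b ← isEq l u
    pure (if b then [] else [x])
  let ok ← assignTypes lt S s.1 (s.1 :: X)
  if ok then do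
    let w ← pick rest
    match w with
    | none => pure (Sum.inr Outcome.representation)
    | some w => do
      let ε ← halve s.2.2
      let l ← readLo w
      let c ← add l ε
      writeLo w c
      writeHi w c
      let rest' ← collect rest fun x => pure (if x = w then [] else [x])
      pure (Sum.inl (w, rest', ε))
  else do
    let C ← zeroCycle s.1 X
    pure (Sum.inr (Outcome.zero C))

/-- Stability of all active pairs is what makes the invariant hold for the next pass whatever its
starting label is. The bound on the labels grows by 1 for the new starting label; with the 1 from
the start of the pass this explains `2 * r` in `PassInv`. -/
theorem finishPass_cost (S : Finset IType) {s : Fin n × List (Fin n) × ℚ} {r : ℕ} {c : ℚ}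
    (hr : r + s.2.1.length + 1 ≤ n) (hε : s.2.2 = 1 / 2 ^ r) (hc : m.lo s.1 = c)
    (tc : Tame n (n + 1 + 2 * r + 1) c)
    (ht : ∀ j ∈ s.2.1, TameAt (n + 1 + 2 * r + 1) m j)
    (hst : ∀ i ∈ s.2.1, ∀ j ∈ s.2.1, Stable lt m.lo m.hi i j) :
    Cost (finishPass lt S s) m (10 ^ 12 * n ^ 2 + 1000 * n ^ 3) fun a m' => match a with
      | .inl s' => PassInv lt s' m' ∧ s'.2.1.length + 1 ≤ s.2.1.length ∧
          totalSlack (m'.lo s'.1) s'.2.1 m' ≤ totalSlack c s.2.1 m + 2 * n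
      | .inr _ => True := by
  obtain ⟨v₀, vs, ε⟩ := s
  dsimp only at hr hε hc ht hst ⊢
  have hn : 1 ≤ n := by omega
  have hvs : vs.length ≤ n := by omega
  have hT : 2 * (n * (36 * n + 2) + 1) + (10 ^ 12 * n ^ 2) + (n + 1) + 54 * n + (n * 2 + 1) +
      200 * n ^ 3 ≤ 10 ^ 12 * n ^ 2 + 1000 * n ^ 3 := by
    have h1 : n ≤ n ^ 2 := by nlinarith
    have h2 : n ^ 2 ≤ n ^ 3 := Nat.pow_le_pow_right hn (by norm_num)
    ring_nf
    omega
  refine Cost.mono ?_ hT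
  unfold finishPass
  refine Cost.bind ((Cost.collect (T := 36 * n) (p := 1)
    (fun x => if decide (m.lo x = m.hi x) = true then [x] else [])
    fun x hx => ⟨by split <;> simp, isEq_labels_cost hn (by omega) (ht x hx)
      (F := fun b => if b = true then [x] else [])⟩).mono
    (T' := n * (36 * n + 2) + 1) (by gcongr)) ?_
  rintro X m ⟨hX, rfl⟩
  rw [flatMap_ite] at hX
  refine Cost.bind ((Cost.collect (T := 36 * n) (p := 1)
    (fun x => if decide (m.lo x = m.hi x) = true then [] else [x])
    fun x hx => ⟨by split <;> simp, isEq_labels_cost hn (by omega) (ht x hx)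
      (F := fun b => if b = true then [] else [x])⟩).mono
    (T' := n * (36 * n + 2) + 1) (by gcongr)) ?_
  rintro rest m ⟨hrest, rfl⟩
  rw [flatMap_ite_not] at hrest
  have lX : X.length ≤ vs.length := by rw [hX]; exact List.length_filter_le _ _
  have lrest : rest.length ≤ vs.length := by rw [hrest]; exact List.length_filter_le _ _
  have sX : ∀ x ∈ X, x ∈ vs := fun x hx => by rw [hX] at hx; exact List.mem_of_mem_filter hx
  have srest : ∀ x ∈ rest, x ∈ vs := fun x hx => by
    rw [hrest] at hx; exact List.mem_of_mem_filter hx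
  clear hX hrest
  refine Cost.bind (assignTypes_cost (B := n + 1 + 2 * r + 1) lt S (X := v₀ :: X) hn (by omega)
    (by rw [List.length_cons]; omega) (by simp) ?_) ?_
  · intro x hx
    rcases List.mem_cons.1 hx with rfl | hx
    · rwa [hc]
    · exact (ht x (sX x hx)).1
  rintro ok m' ⟨hlo, hhi⟩
  refine Cost.ite (fun _ => ?_) fun _ => ?_
  · refine Cost.bind ((Cost.pick _).mono (T' := n + 1) (by omega)) ?_
    rintro w _ ⟨-, hw, rfl⟩
    cases w with
    | none => exact Cost.pure trivial
    | some w =>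
      replace hw := hw w rfl
      have hwv := srest w hw
      have tε : Tame n 1 ε := by rw [hε]; exact tame_pow_half (by omega)
      have eε : ε / 2 = 1 / 2 ^ (r + 1) := by rw [hε, pow_succ, div_div]
      have tε' : Tame n 1 (ε / 2) := by rw [eε]; exact tame_pow_half (by omega)
      have tw : Tame n (n + 1 + 2 * r + 1) (m'.lo w) := by rw [hlo]; exact (ht w hwv).1
      have tc' := tw.add tε'
      have b1 := tε.bits_le (by omega) hn
      have b2 := tε'.bits_le (by omega) hn
      have b3 := tw.bits_le (by omega) hn
      have b4 := tc'.bits_le (by omega) hn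
      refine Cost.bind ((Cost.halve _).mono (T' := 9 * n) b1) ?_
      rintro _ _ ⟨rfl, rfl⟩
      refine Cost.bind ((Cost.load _ _).mono (T' := 9 * n) b3) ?_
      rintro _ _ ⟨rfl, rfl⟩
      refine Cost.bind ((Cost.add _ _).mono (T' := 18 * n) (by dsimp only; omega)) ?_
      rintro _ _ ⟨rfl, rfl⟩
      refine Cost.bind ((Cost.store _ _).mono (T' := 9 * n) b4) ?_
      rintro _ _ rfl
      refine Cost.bind ((Cost.store _ _).mono (T' := 9 * n) b4) ?_
      rintro _ _ rfl
      refine Cost.bind (filter_cost (by omega) w) ?_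
      rintro rest' _ ⟨hrest', rfl⟩
      have lrest' : rest'.length < rest.length := by
        rw [hrest']
        exact List.length_filter_lt_length_iff_exists.2 ⟨w, hw, by simp⟩
      have srest' : ∀ x ∈ rest', x ∈ vs ∧ x ≠ w := fun x hx => by
        rw [hrest', List.mem_filter] at hx
        exact ⟨srest x hx.1, by simpa using hx.2⟩
      -- At least `w` leaves the active list, so `r + s.2.1.length + 1 ≤ n` persists. It keeps `r`
      -- below n, as needed for 1/2^r and for the size of the labels.
      refine Cost.pure ⟨⟨r + 1, ?_, fun h => (srest' w h).2 rfl, eε, ?_, ?_, ?_, ?_, ?_⟩, ?_, ?_⟩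
      · dsimp only; omega
      · simp
      · simpa using tc'.mono (by omega)
      · intro j hj
        obtain ⟨h1, h2⟩ := srest' j hj
        have := ht j h1
        simpa [h2, hlo, hhi] using
          And.intro (this.1.mono (B' := n + 1 + 2 * (r + 1)) (by omega))
            (this.2.mono (B' := n + 1 + 2 * (r + 1)) (by omega))
      · intro i hi _ j hj z hz
        obtain ⟨h1, h2⟩ := srest' i hi
        obtain ⟨h3, h4⟩ := srest' j hj
        simpa [h2, h4, hlo] using (hst i h1 j h3).1 z hz
      · intro i hi _ j hj z hz
        obtain ⟨h1, h2⟩ := srest' i hi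
        obtain ⟨h3, h4⟩ := srest' j hj
        simpa [h2, h4, hhi] using (hst i h1 j h3).2 z hz
      · dsimp only; omega
      · simp only [totalSlack, Function.update_self, hlo, hhi]
        calc _ ≤ ∑ j ∈ rest'.toFinset, (slack c m.lo m.hi j + 2) := by
              refine Finset.sum_le_sum fun j hj => ?_
              rw [slack_update_of_ne (srest' j (by simpa using hj)).2]
              exact slack_change _ _ _ _
          _ = ∑ j ∈ rest'.toFinset, slack c m.lo m.hi j + rest'.toFinset.card * 2 := by
              rw [Finset.sum_add_distrib, Finset.sum_const, smul_eq_mul]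
          _ ≤ _ := by
              have h1 : rest'.toFinset ⊆ vs.toFinset := fun x hx => by
                simpa using (srest' x (by simpa using hx)).1
              have h2 := Finset.sum_le_sum_of_subset (f := slack c m.lo m.hi) h1
              have h3 := toFinset_card_le (vs := rest') (by omega)
              omega
  · refine Cost.bind (zeroCycle_cost hn v₀ (by omega)) ?_
    exact fun _ _ _ => Cost.pure trivial

/-- Work not covered by slack, including the n² initial zeros of `M`, is O(n⁴) and paid by the term
10^13 n⁴ of this pass. The new slack of at most 2n comes from the prepaid `2 * n` per active
element, as the active list gets shorter. -/
theorem pass_exec (hirr : ∀ i, lt i i = false) (S : Finset IType)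
    (s : Fin n × List (Fin n) × ℚ) (m : Mem n) (h : PassInv lt s m) :
    Exec (pass lt S s) m fun a m' k => match a with
      | .inl s' => PassInv lt s' m' ∧ k + 1 + timeLeft s' m' ≤ timeLeft s m
      | .inr _ => True ∧ k + 1 + 0 ≤ timeLeft s m := by
  obtain ⟨r, hr, hv₀, hε, hc, tc, hA⟩ := h
  have hn : 1 ≤ n := by omega
  have hvs : s.2.1.length ≤ n := by omega
  have hp : 200 * n ^ 2 + 400 * n ^ 2 * (n * n + 1) + (10 ^ 12 * n ^ 2 + 1000 * n ^ 3) + 1 ≤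
      10 ^ 13 * n ^ 4 := by
    have h0 : 1 ≤ n ^ 2 := Nat.one_le_pow _ _ hn
    have h1 : n ^ 2 ≤ n ^ 4 := Nat.pow_le_pow_right hn (by norm_num)
    have h2 : n ^ 3 ≤ n ^ 4 := Nat.pow_le_pow_right hn (by norm_num)
    ring_nf
    omega
  refine Exec.bind (startPass_cost hn hvs hv₀ (by omega) ⟨rfl, hc⟩ tc hA) ?_
  rintro _ m₁ k₁ ⟨hk₁, hA₁, hc₁, hM, hsl⟩
  have hsum : totalSlack (m.lo s.1) s.2.1 m₁ ≤ totalSlack (m.lo s.1) s.2.1 m :=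
    Finset.sum_le_sum fun j _ => hsl j
  refine Exec.bind (labelingLoop_exec hirr hn hvs hv₀ (by omega) hc₁ hA₁ hM) ?_
  rintro res m₂ k₂ ⟨hres, hk₂⟩
  have hrounds : 400 * n ^ 2 * (rounds (m.lo s.1) s.2.1 m₁ + 1) ≤ 400 * n ^ 2 * (n * n + 1) +
      400 * n ^ 2 * (2 * n + 1) * totalSlack (m.lo s.1) s.2.1 m := by
    rw [mul_assoc (400 * n ^ 2) (2 * n + 1), ← mul_add]
    refine Nat.mul_le_mul_left _ ?_
    have h1 := zeros_card_le hvs m₁.M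
    have h2 := Nat.mul_le_mul_left (2 * n + 1) hsum
    simp only [rounds, totalSlack] at h2 ⊢
    omega
  have htime : timeLeft s m = 10 ^ 13 * n ^ 4 * s.2.1.length + 10 ^ 13 * n ^ 4 +
      (400 * n ^ 2 * (2 * n + 1) * totalSlack (m.lo s.1) s.2.1 m +
        400 * n ^ 2 * (2 * n + 1) * (2 * n * s.2.1.length)) := by
    simp only [timeLeft]
    ring
  cases res with
  | some v =>
    refine Exec.bind (positiveCycle_cost lt hn s.1 v) ?_
    rintro C m₃ k₃ ⟨hk₃, -⟩
    refine ⟨_, _, 0, Runs.pure _ _, trivial, ?_⟩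
    simp only [reduceCtorEq, if_false] at hk₂
    omega
  | none =>
    obtain ⟨hc₂, hA₂, hst⟩ := hres rfl
    -- The remainder of `pass` is definitionally `finishPass`.
    refine Exec.imp (finishPass_cost S hr hε hc₂.1 (tc.mono (by omega)) hA₂.tame hst) ?_
    simp only [if_true] at hk₂
    rw [← mul_assoc (400 * n ^ 2)] at hk₂
    change k₂ + 400 * n ^ 2 * (2 * n + 1) * totalSlack (m.lo s.1) s.2.1 m₂ ≤ _ at hk₂
    rintro (s' | o) m₃ k₃ ⟨hk₃, hq⟩
    · obtain ⟨hI, hlen, hslack⟩ := hq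
      refine ⟨hI, ?_⟩
      have h1 := Nat.mul_le_mul_left (10 ^ 13 * n ^ 4) hlen
      have h2 : totalSlack (m₃.lo s'.1) s'.2.1 m₃ + 2 * n * s'.2.1.length ≤
          totalSlack (m.lo s.1) s.2.1 m₂ + 2 * n * s.2.1.length := by
        have := Nat.mul_le_mul_left (2 * n) hlen
        rw [Nat.mul_succ] at this
        omega
      have h3 := Nat.mul_le_mul_left (400 * n ^ 2 * (2 * n + 1)) h2
      rw [mul_add (400 * n ^ 2 * (2 * n + 1)) (totalSlack (m.lo s.1) s.2.1 m₂)] at h3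
      simp only [timeLeft] at htime ⊢
      omega
    · refine ⟨trivial, ?_⟩
      omega

theorem slack_start : slack (n := n) 0 (fun _ => -(n : ℚ) - 1) (fun _ => n + 1) =
    fun _ => 2 * n + 2 := by
  funext j
  have h1 : IntDiff 0 (-(n : ℚ) - 1) := ⟨-n - 1, by push_cast; ring⟩
  have h2 : IntDiff 0 ((n : ℚ) + 1) := ⟨n + 1, by push_cast; ring⟩
  rw [slack, off_eq_zero h1, off_eq_zero h2]
  have : (n : ℚ) + 1 - (-n - 1) + 0 + 0 = ((2 * n + 2 : ℕ) : ℤ) := by push_cast; ring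
  rw [this, Int.floor_intCast, Int.toNat_natCast]

theorem recognize_exec (hn : 1 ≤ n) (hirr : ∀ i, lt i i = false) (S : Finset IType) (m : Mem n) :
    Exec (recognize lt S) m fun _ _ k => k ≤ 2 * 10 ^ 13 * n ^ 5 := by
  have hL : (List.finRange n).length = n := List.length_finRange
  refine Exec.bind (Cost.tick n) ?_
  rintro _ m k₁ ⟨hk₁, rfl⟩
  refine Exec.bind (Cost.pick _) ?_
  rintro v _ k₂ ⟨hk₂, -, -, rfl⟩
  rw [hL] at hk₂
  have h12 : n + (n + 1) ≤ 10 ^ 13 * n ^ 5 := by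
    have : n ≤ n ^ 5 := Nat.le_self_pow (by norm_num) n
    omega
  cases v with
  | none => exact ⟨_, _, 0, Runs.pure _ _, by omega⟩
  | some v₀ =>
  have tlo : Tame n (n + 1) (-(n : ℚ) - 1) := by
    have := tame_int (n := n) (B := n + 1) (-n - 1)
      (by rw [abs_le]; constructor <;> push_cast <;> omega)
    simpa using this
  have thi : Tame n (n + 1) ((n : ℚ) + 1) := by
    have := tame_int (n := n) (B := n + 1) (n + 1)
      (by rw [abs_le]; constructor <;> push_cast <;> omega)
    simpa using this
  have t0 : Tame n (n + 1) (0 : ℚ) := by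
    simpa using tame_int (n := n) (B := n + 1) 0 (by simp; omega)
  have b1 := tlo.bits_le (by omega) hn
  have b2 := thi.bits_le (by omega) hn
  have b3 := t0.bits_le (by omega) hn
  generalize ({ m with clock := m.clock + 1 } : Mem n) = m
  refine Exec.bind ((Cost.forEach (T := 18 * n) (fun rest m' =>
    ∀ j, j ∉ rest → m'.lo j = -(n : ℚ) - 1 ∧ m'.hi j = n + 1) ?_ ?_).mono
    (T' := n * (18 * n + 1) + 1) (by rw [hL])) ?_
  · rintro x rest m - h
    refine Cost.bind (Cost.store _ _) ?_
    rintro _ _ rfl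
    refine (Cost.store _ _).imp (by omega) ?_
    rintro _ _ rfl
    intro j hj
    by_cases e : j = x
    · subst e; simp
    · simpa [e] using h j (by simp [e, hj])
  · exact fun j hj => absurd (List.mem_finRange j) hj
  rintro _ m k₃ ⟨hk₃, hm⟩
  replace hm : m.lo = (fun _ => -(n : ℚ) - 1) ∧ m.hi = fun _ => (n : ℚ) + 1 :=
    ⟨funext fun j => (hm j (by simp)).1, funext fun j => (hm j (by simp)).2⟩
  refine Exec.bind ((Cost.store _ _).mono b3) ?_
  rintro _ _ k₄ ⟨hk₄, rfl⟩
  refine Exec.bind ((Cost.store _ _).mono b3) ?_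
  rintro _ _ k₅ ⟨hk₅, rfl⟩
  refine Exec.bind (filter_cost hL.le v₀) ?_
  rintro vs _ k₆ ⟨hk₆, hvs, rfl⟩
  have lvs : vs.length < n := by
    rw [hvs]
    conv_rhs => rw [← hL]
    exact List.length_filter_lt_length_iff_exists.2 ⟨v₀, by simp, by simp⟩
  have hne : ∀ j ∈ vs, j ≠ v₀ := fun j hj => by
    rw [hvs, List.mem_filter] at hj
    simpa using hj.2
  have i1 : IntDiff 0 (-(n : ℚ) - 1) := ⟨-n - 1, by push_cast; ring⟩
  have i2 : IntDiff 0 ((n : ℚ) + 1) := ⟨n + 1, by push_cast; ring⟩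
  refine Exec.imp (loop_exec (PassInv lt) timeLeft (Q := fun _ _ => True) (fun _ _ => 0)
    (fun s m h => (pass_exec hirr S s m h).imp (by rintro (s' | o) _ _ h <;> exact h)) ?_) ?_
  · refine ⟨0, by dsimp only; omega, fun h => hne _ h rfl, by norm_num, by simp, ?_, ?_, ?_, ?_⟩
    · simpa using t0
    · intro j hj
      simpa [hne j hj, hm.1, hm.2] using And.intro tlo thi
    -- All initial labels are integers and c = 0, so no label lies outside the class and both
    -- stability conditions are vacuous.
    · intro i hi hc
      simp [hne i hi, hm.1, i1] at hc
    · intro i hi hc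
      simp [hne i hi, hm.2, i2] at hc
  · rintro _ _ k₇ ⟨-, hk₇⟩
    have hs : ∀ c, c = 0 → ∀ lo hi : Fin n → ℚ, lo = Function.update m.lo v₀ 0 →
        hi = Function.update m.hi v₀ 0 → ∑ j ∈ vs.toFinset, slack c lo hi j ≤ n * (2 * n + 2) := by
      rintro _ rfl _ _ rfl rfl
      refine (Finset.sum_le_card_nsmul _ _ (2 * n + 2) fun j hj => ?_).trans ?_
      · rw [slack_update_of_ne (hne j (by simpa using hj)), hm.1, hm.2, slack_start]
      · exact Nat.mul_le_mul_right _ (toFinset_card_le lvs.le)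
    -- The initial potential: at most n passes, slack 2n + 2 for each element, and 2n prepaid for
    -- each later pass.
    have ht : k₇ ≤ 10 ^ 13 * n ^ 4 * n +
        400 * n ^ 2 * (2 * n + 1) * (n * (2 * n + 2) + 2 * n * n) := by
      refine (Nat.le_add_right k₇ 0).trans (hk₇.trans ?_)
      refine Nat.add_le_add (Nat.mul_le_mul_left _ lvs) (Nat.mul_le_mul_left _ (Nat.add_le_add ?_
        (Nat.mul_le_mul_left _ lvs.le)))
      exact hs _ (by simp) _ _ rfl rfl
    have h1 : n ^ 1 ≤ n ^ 5 := Nat.pow_le_pow_right hn (by norm_num)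
    have h2 : n ^ 2 ≤ n ^ 5 := Nat.pow_le_pow_right hn (by norm_num)
    have h3 : n ^ 3 ≤ n ^ 5 := Nat.pow_le_pow_right hn (by norm_num)
    have h4 : n ^ 4 ≤ n ^ 5 := Nat.pow_le_pow_right hn (by norm_num)
    ring_nf at ht hk₃ h1 ⊢
    omega

end Algorithm

end SOrder

theorem mainTheorem8 :
    ∃ K : ℕ, ∀ (X : Type*) [Fintype X] [Nonempty X] [PartialOrder X] [DecidableLT X]
      (e : Fin (Fintype.card X) ≃ X) (S : Finset SOrder.IType), S.Nonempty →
      ∀ ω : ℕ → ℕ,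
        SOrder.RunsWithin
          (SOrder.recognize (fun i j => decide (e i < e j)) S)
          (SOrder.Mem.blank (Fintype.card X) ω)
          (K * Fintype.card X ^ 5) := by
  -- One 10^13 comes from the passes; the other absorbs the slack term and the initialization.
  refine ⟨2 * 10 ^ 13, fun X _ _ _ _ e S _ ω => ?_⟩
  obtain ⟨a, m', k, hr, hk⟩ := SOrder.recognize_exec (lt := fun i j => decide (e i < e j))
    Fintype.card_pos (by simp) S (SOrder.Mem.blank _ ω)
  exact ⟨a, m', _, hr _ hk⟩
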